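/- For an integer $n\ge 1$ and reals $t,g$ let $\mathrm{GHD}_{n,t,g}:\{0,1\}^n\times\{0,1\}^n\to\{0,1,\star\}$ be the partial function that takes the value $0$ at $(x,y)$ if $\Delta(x,y)\le t-g$, the value $1$ if $\Delta(x,y)>t+g$, and the value $\star$ ("do not care") otherwise, where $\Delta$ is the Hamming distance. For a deterministic two-party communication protocol $P$ (Alice holds $x$, Bob holds $y$; they exchange bits in turns fixed by the bits sent so far, and the output $P(x,y)\in\{0,1\}$ is determined by the bits exchanged) let $\mathrm{cost}(P)$ be the worst-case number of bits communicated. For a partial function $f$, a probability distribution $\mu$ on the inputs and $\varepsilon\ge 0$, the $\varepsilon$-error $\mu$-distributional complexity $D_{\mu,\varepsilon}(f)$ is the minimum of $\mathrm{cost}(P)$ over all deterministic protocols $P$ with $$\Pr_{(x,y)\sim\mu}\bigl[f(x,y)\ne\star\ \wedge\ P(x,y)\ne f(x,y)\bigr]\le\varepsilon .$$ Let $\xi_0$ be the uniform distribution on $\{0,1\}^n\times\{0,1\}^n$. **Theorem (Hardness Under Uniform Distribution).** There exists an absolute constant $\varepsilon>0$ for which $D_{\xi_0,\varepsilon}(\mathrm{GHD}_{n,n/2,\sqrt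 n})=\Omega(n)$; that is, there exist absolute constants $\varepsilon>0$, $c>0$ and $N$ such that for every integer $n\ge N$, $$D_{\xi_0,\varepsilon}\bigl(\mathrm{GHD}_{n,n/2,\sqrt n}\bigr)\ \ge\ c\,n .$$ -/

import Mathlib

/-!
Deterministic two-party communication protocols, distributional complexity of a partial Boolean
function, and the Gap-Hamming-Distance problem.
-/

namespace CommComplexity

/-- Deterministic two-party protocols with Alice's inputs in `X`, Bob's inputs in `Y` and Boolean
outputs, as binary trees. At a leaf the output is announced (it is a function of the transcript
alone). At an internal node one player, fixed by the node, sends one bit, a function of that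
player's own input (and, through the node, of the bits sent so far); the protocol continues in
`zero` or `one` according to this bit. -/
inductive Protocol (X Y : Type*) where
  | output (z : Bool) : Protocol X Y
  | alice (q : X → Bool) (zero one : Protocol X Y) : Protocol X Y
  | bob (q : Y → Bool) (zero one : Protocol X Y) : Protocol X Y

namespace Protocol

variable {X Y : Type*}

/-- The output `P(x, y)` of the protocol on input `(x, y)`. -/
def run : Protocol X Y → X → Y → Bool
  | output z, _, _ => z
  | alice q zero one, x, y => if q x then one.run x y else zero.run x y
  | bob q zero one, x, y => if q y then one.run x y else zero.run x y

/-- The worst-case number of bits communicated: the height of the protocol tree. -/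
def cost : Protocol X Y → ℕ
  | output _ => 0
  | alice _ zero one => 1 + max zero.cost one.cost
  | bob _ zero one => 1 + max zero.cost one.cost

/-- `err_μ(P)`: the probability under `μ` that `f` is defined at the input and the protocol's
output differs from its value. The value `none` of `f` stands for "do not care". -/
noncomputable def err (f : X → Y → Option Bool) (μ : PMF (X × Y)) (P : Protocol X Y) : ℝ :=
  (μ.toOuterMeasure
    {p : X × Y | f p.1 p.2 ≠ none ∧ some (P.run p.1 p.2) ≠ f p.1 p.2}).toReal

end Protocol

/-- The `ε`-error `μ`-distributional communication complexity `D_{μ,ε}(f)`: the least cost of a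
deterministic protocol whose error under `μ` is at most `ε`. -/
noncomputable def distComplexity {X Y : Type*} (f : X → Y → Option Bool) (μ : PMF (X × Y))
    (ε : ℝ) : ℕ :=
  sInf {c : ℕ | ∃ P : Protocol X Y, P.err f μ ≤ ε ∧ P.cost = c}

/-- Every total Boolean function on finite input sets is computed by some protocol. -/
theorem Protocol.exists_run_eq {X Y : Type*} [Finite X] (F : X → Y → Bool) :
    ∃ P : Protocol X Y, ∀ x y, P.run x y = F x y := by
  classical
  have := Fintype.ofFinite X
  have key : ∀ s : Finset X, ∃ P : Protocol X Y, ∀ x ∈ s, ∀ y, P.run x y = F x y := by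
    intro s
    induction s using Finset.induction_on with
    | empty => exact ⟨.output false, by simp⟩
    | insert a s _ ih =>
      obtain ⟨P, hP⟩ := ih
      refine ⟨.alice (fun x => decide (x = a)) P
        (.bob (F a) (.output false) (.output true)), fun x hx y => ?_⟩
      by_cases h : x = a
      · subst h
        simp [Protocol.run]
      · simp [Protocol.run, h, hP x ((Finset.mem_insert.1 hx).resolve_left h)]
  obtain ⟨P, hP⟩ := key Finset.univ
  exact ⟨P, fun x => hP x (Finset.mem_univ x)⟩

/-- On finite input sets and for `0 ≤ ε`, the minimum defining `distComplexity` is over a nonempty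
set, hence is attained. -/
theorem exists_cost_eq_distComplexity {X Y : Type*} [Finite X] (f : X → Y → Option Bool)
    (μ : PMF (X × Y)) {ε : ℝ} (hε : 0 ≤ ε) :
    ∃ P : Protocol X Y, P.err f μ ≤ ε ∧ P.cost = distComplexity f μ ε := by
  obtain ⟨P, hP⟩ := Protocol.exists_run_eq (fun (x : X) (y : Y) => (f x y).getD false)
  have h0 : P.err f μ = 0 := by
    have : {p : X × Y | f p.1 p.2 ≠ none ∧ some (P.run p.1 p.2) ≠ f p.1 p.2} = ∅ := by
      ext p
      simp only [Set.mem_ofPred_eq, Set.mem_empty_iff_false, iff_false, not_and, not_not, hP]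
      intro h
      cases hf : f p.1 p.2 <;> simp_all
    simp [Protocol.err, this]
  have hne : {c : ℕ | ∃ P : Protocol X Y, P.err f μ ≤ ε ∧ P.cost = c}.Nonempty :=
    ⟨P.cost, P, h0 ▸ hε, rfl⟩
  exact Nat.sInf_mem hne

open Classical in
/-- The Gap-Hamming-Distance partial function `GHD_{n,t,g}` on `{0,1}^n × {0,1}^n`; the value
`none` stands for "do not care". -/
noncomputable def GHD (n : ℕ) (t g : ℝ) (x y : Fin n → Bool) : Option Bool :=
  if (hammingDist x y : ℝ) ≤ t - g then some false
  else if t + g < (hammingDist x y : ℝ) then some true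
  else none

end CommComplexity

/-!
A linear lower bound for Gap-Hamming-Distance under the uniform distribution.

Write `corr x y` for the number of agreements minus the number of disagreements of two bit strings,
so that the two values of the partial function correspond to `corr x y ≥ 2√n` and
`corr x y < -2√n`.

*Large rectangles spread* (`largeRectanglesSpread`). On a rectangle `A × B` whose sides have
density at least `exp (-c m)` in the cube of dimension `m`, the correlation exceeds any prescribed
multiple `T√m` with probability bounded away from zero. Otherwise many `y ∈ B` satisfy
`|corr x y| ≤ T√m` for almost all `x ∈ A`. These `y` are exponentially dense, and the projection of
a random sign vector to a subspace of small dimension is short except with exponentially small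
probability (`exists_sum_exp_norm_starProjection_sq_le`), so that linearly many of them can be
chosen one by one, each with a component of length at least `σ√m` orthogonal to its predecessors.
Now replace `x` by the Gaussian vector `G` with signs `x` and independent absolute values. Passing
from `x` to `G` adds to the correlation a noise whose variance proxy `v` is below `1`, because `|g|`
has variance below `1` (`exists_mgf_abs_gaussian_le`); a shifted Gaussian with standard deviation
`σ > √v` exceeds a high threshold `T'√m` far more often than this noise makes `⟪y, G⟫` exceed it
(`exists_threshold`). Since orthogonal components of `G` are independent, each chosen `y` costs a
constant factor (`lintegral_mul_le_of_shift_le`), and the probability that `|⟪y, G⟫| ≤ T'√m` for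
almost all chosen `y` is exponentially small. This bounds the density of `A`.

*Reduction* (`distComplexity_of_spread`). Split the `n` coordinates into two halves, and fix the
second halves of both inputs to pads with correlation in `[8√k, 14√k]`, respectively in
`[-14√k, -8√k]`. Such pads have constant density (`exists_card_corr_window`), so by averaging there
are pads for which the protocol has small error on the first halves (`exists_pad`). On inputs of
small correlation the protocol outputs `false` with the first and `true` with the second pads, and
on inputs of correlation beyond `36√m` it does so only by an error. The inputs with this pair of
outputs are a union of at most `4 ^ C` rectangles, `C` being the cost, and the large ones contain
a constant fraction of inputs with correlation beyond `36√m`. Hence the error is not small, unless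
the small rectangles prevail, which takes `C` linear in `n`.
-/

namespace GapHamming

open MeasureTheory ProbabilityTheory Real CommComplexity
open scoped ENNReal RealInnerProductSpace

/-! ### Correlation of bit strings -/

/-- The sign `(-1) ^ b` of a bit. -/
def sgn (b : Bool) : ℝ := if b then -1 else 1

/-- The correlation `∑ j, (-1) ^ x j * (-1) ^ y j` of two bit strings, which is the number of
agreements minus the number of disagreements. -/
def corr {ι : Type*} [Fintype ι] (x y : ι → Bool) : ℝ := ∑ j, sgn (x j) * sgn (y j)

lemma abs_sgn (b : Bool) : |sgn b| = 1 := by cases b <;> simp [sgn]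

lemma sgn_not (b : Bool) : sgn (!b) = -sgn b := by cases b <;> simp [sgn]

lemma sgn_eq_or (b : Bool) : sgn b = 1 ∨ sgn b = -1 := by cases b <;> simp [sgn]

lemma one_add_sq_div_two_le_cosh (s : ℝ) : 1 + s ^ 2 / 2 ≤ cosh s := by
  have h1 : |s / 2| ≤ |sinh (s / 2)| := by
    rw [abs_sinh]
    exact self_le_sinh_iff.2 (abs_nonneg _)
  have h2 := sq_le_sq.2 h1
  have h3 := cosh_two_mul (s / 2)
  have h4 := cosh_sq (s / 2)
  rw [mul_div_cancel₀ s two_ne_zero] at h3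
  rw [h3, h4]
  linarith [h2, show (s / 2) ^ 2 = s ^ 2 / 4 by ring]

lemma exp_neg_two_le : exp (-2) ≤ 1 / 4 := by
  rw [exp_neg, ← one_div]
  apply one_div_le_one_div_of_le (by norm_num)
  have := add_one_le_exp (1 : ℝ)
  calc (4 : ℝ) ≤ exp 1 * exp 1 := by nlinarith
    _ = exp 2 := by rw [← exp_add]; norm_num

section Corr

variable {ι : Type*} [Fintype ι]

lemma corr_eq_card_sub_hammingDist (x y : ι → Bool) :
    corr x y = Fintype.card ι - 2 * (hammingDist x y : ℝ) := by
  have h : ∀ j, sgn (x j) * sgn (y j) = 1 - 2 * (if x j ≠ y j then (1 : ℝ) else 0) := by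
    intro j
    cases x j <;> cases y j <;> norm_num [sgn]
  simp only [corr, h, Finset.sum_sub_distrib, ← Finset.mul_sum, hammingDist, Finset.sum_boole]
  simp

lemma corr_not_right (x y : ι → Bool) : corr x (fun j => !y j) = -corr x y := by
  simp [corr, sgn_not]

lemma corr_append {m k : ℕ} (x y : Fin m → Bool) (u v : Fin k → Bool) :
    corr (Fin.append x u) (Fin.append y v) = corr x y + corr u v := by
  simp [corr, Fin.sum_univ_add]

section DecidableEq
variable [DecidableEq ι]

lemma sum_exp_sum_sgn (a : ι → ℝ) :
    ∑ y : ι → Bool, exp (∑ j, a j * sgn (y j)) = ∏ j, (2 * cosh (a j)) := by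
  have h : ∀ j, 2 * cosh (a j) = ∑ b : Bool, exp (a j * sgn b) := by
    intro j
    rw [cosh_eq]
    simp [sgn]
    ring
  simp only [h, Finset.prod_univ_sum, Real.exp_sum, Fintype.piFinset_univ]

lemma sum_exp_corr (x : ι → Bool) (s : ℝ) :
    ∑ y : ι → Bool, exp (s * corr x y) = 2 ^ Fintype.card ι * cosh s ^ Fintype.card ι := by
  have h : ∀ y : ι → Bool, s * corr x y = ∑ j, (s * sgn (x j)) * sgn (y j) := by
    intro y
    simp [corr, Finset.mul_sum, mul_assoc]
  have h2 : ∀ j, cosh (s * sgn (x j)) = cosh s := by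
    intro j
    rcases sgn_eq_or (x j) with h | h <;> simp [h]
  simp only [h, sum_exp_sum_sgn, h2, Finset.prod_const, Finset.card_univ, mul_pow]

lemma sum_exp_corr_le (x : ι → Bool) (s : ℝ) :
    ∑ y : ι → Bool, exp (s * corr x y)
      ≤ 2 ^ Fintype.card ι * exp (Fintype.card ι * s ^ 2 / 2) := by
  rw [sum_exp_corr]
  gcongr
  calc cosh s ^ Fintype.card ι ≤ exp (s ^ 2 / 2) ^ Fintype.card ι := by
        gcongr
        exact cosh_le_exp_half_sq s
    _ = _ := by rw [← Real.exp_nat_mul]; ring_nf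

end DecidableEq

end Corr

open Finset in
/-- For a fixed string, at least half of all strings have correlation `O(√m)` with it. -/
lemma card_abs_corr_le (m : ℕ) (hm : 0 < m) (x : Fin m → Bool) :
    (2 : ℝ) ^ m / 2 ≤ #{y : Fin m → Bool | |corr x y| ≤ 2 * √m} := by
  classical
  have hm' : (0 : ℝ) < √m := by positivity
  have hsq : √(m : ℝ) ^ 2 = m := Real.sq_sqrt (by positivity)
  have tail : ∀ s : ℝ, s = 1 ∨ s = -1 →
      (#{y : Fin m → Bool | 2 * √m < s * corr x y} : ℝ) ≤ 2 ^ m * exp (-2) := by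
    intro s hs
    have hs2 : s ^ 2 = 1 := by rcases hs with rfl | rfl <;> norm_num
    have h1 := sum_exp_corr_le x (s * (2 / √m))
    have h2 : ∑ y : Fin m → Bool with 2 * √m < s * corr x y, exp 4
        ≤ ∑ y : Fin m → Bool, exp (s * (2 / √m) * corr x y) := by
      refine (sum_le_sum fun y hy => ?_).trans
        (sum_le_sum_of_subset_of_nonneg (filter_subset _ _) fun _ _ _ => (exp_pos _).le)
      have hy := (mem_filter.1 hy).2
      apply exp_le_exp.2
      calc (4 : ℝ) = 2 / √m * (2 * √m) := by field_simp; norm_num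
        _ ≤ 2 / √m * (s * corr x y) := by gcongr
        _ = _ := by ring
    rw [sum_const, nsmul_eq_mul] at h2
    have h3 : ((Fintype.card (Fin m) : ℕ) : ℝ) * (s * (2 / √m)) ^ 2 / 2 = 2 := by
      rw [mul_pow, div_pow, hsq, hs2, Fintype.card_fin]
      field_simp
    rw [h3, Fintype.card_fin] at h1
    have h4 := h2.trans h1
    have h5 : exp (-2) = exp 2 * exp (-4) := by rw [← exp_add]; norm_num
    have h6 : exp (4 : ℝ) * exp (-4) = 1 := by rw [← exp_add]; norm_num
    rw [h5, ← mul_assoc]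
    calc _ = _ * exp 4 * exp (-4) := by rw [mul_assoc, h6, mul_one]
      _ ≤ _ := by gcongr
  have h1 := tail 1 (Or.inl rfl)
  have h2 := tail (-1) (Or.inr rfl)
  have h3 : (univ : Finset (Fin m → Bool)) ⊆
      ({y : Fin m → Bool | |corr x y| ≤ 2 * √m} : Finset _) ∪
      (({y : Fin m → Bool | 2 * √m < 1 * corr x y} : Finset _) ∪
       ({y : Fin m → Bool | 2 * √m < (-1) * corr x y} : Finset _)) := by
    intro y _
    simp only [mem_union, mem_filter, mem_univ, true_and]
    by_contra! h
    exact absurd (abs_le.2 ⟨by linarith [h.2.2], by linarith [h.2.1]⟩) (not_le.2 h.1)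
  have h4 := (card_le_card h3).trans ((card_union_le _ _).trans
    (Nat.add_le_add_left (card_union_le _ _) _))
  have h5 : (2 : ℝ) ^ m = ((univ : Finset (Fin m → Bool)).card : ℝ) := by simp
  have h6 := (Nat.cast_le (α := ℝ)).2 h4
  push_cast at h6
  have h7 : exp (-2) ≤ 1 / 4 := exp_neg_two_le
  have h8 : (2 : ℝ) ^ m * exp (-2) ≤ 2 ^ m * (1 / 4) := by gcongr
  linarith

open Finset in
/-- For a fixed string, a constant fraction of all strings has correlation in the window
`[8√k, 14√k]` with it. Under the exponentially tilted weight `exp (11 corr / √k)` the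
correlation concentrates around `11√k`, and undoing the tilt costs only a constant factor. -/
lemma exists_card_corr_window :
    ∃ α : ℝ, 0 < α ∧ ∃ K : ℕ, ∀ k : ℕ, K ≤ k → ∀ u : Fin k → Bool,
      α * 2 ^ k ≤ #{v : Fin k → Bool | 8 * √k ≤ corr u v ∧ corr u v ≤ 14 * √k} := by
  classical
  have hlim := Real.tendsto_one_add_div_pow_exp (121 / 2 : ℝ)
  have hev := hlim.eventually (eventually_ge_nhds (b := exp (121 / 2 : ℝ) / 2)
    (by linarith [exp_pos (121 / 2 : ℝ)]))
  obtain ⟨K, hK⟩ := Filter.eventually_atTop.1 hev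
  refine ⟨exp (-154) * (exp (121 / 2) / 4), by positivity, max K 1, fun k hk u => ?_⟩
  have hk1 : 0 < k := le_of_max_le_right hk
  have hk' : (0 : ℝ) < √k := by positivity
  have hsq : √(k : ℝ) ^ 2 = k := Real.sq_sqrt (by positivity)
  have key := hK k (le_of_max_le_left hk)
  set W : Finset (Fin k → Bool) := {v | 8 * √k ≤ corr u v ∧ corr u v ≤ 14 * √k} with hW
  have hlow : 2 ^ k * (exp (121 / 2) / 2)
      ≤ ∑ v : Fin k → Bool, exp (11 / √k * corr u v) := by
    rw [sum_exp_corr, Fintype.card_fin]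
    gcongr
    refine le_trans key ?_
    gcongr
    have h1 := one_add_sq_div_two_le_cosh (11 / √k)
    refine le_trans (le_of_eq ?_) h1
    rw [div_pow, hsq]
    ring
  have hside : ∀ r : ℝ, ((Fintype.card (Fin k) : ℕ) : ℝ) * (r / √k) ^ 2 / 2 = r ^ 2 / 2 := by
    intro r
    rw [div_pow, hsq, Fintype.card_fin]
    field_simp
  have hA := sum_exp_corr_le u (10 / √k)
  have hB := sum_exp_corr_le u (12 / √k)
  rw [hside, Fintype.card_fin] at hA hB
  have hpt : ∀ v : Fin k → Bool, exp (11 / √k * corr u v) ≤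
      (if v ∈ W then exp 154 else 0) + exp 8 * exp (10 / √k * corr u v)
        + exp (-14) * exp (12 / √k * corr u v) := by
    intro v
    rw [← exp_add, ← exp_add]
    set z := corr u v / √k with hz
    have e1 : ∀ c : ℝ, c / √k * corr u v = c * z := fun c => by rw [hz]; ring
    rw [e1, e1, e1]
    have p1 := exp_pos (8 + 10 * z)
    have p2 := exp_pos (-14 + 12 * z)
    by_cases h1 : 8 * √k ≤ corr u v
    · by_cases h2 : corr u v ≤ 14 * √k
      · have : v ∈ W := by simp [hW, h1, h2]
        rw [if_pos this]
        have hz2 : z ≤ 14 := by rw [hz, div_le_iff₀ hk']; exact h2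
        have : exp (11 * z) ≤ exp 154 := exp_le_exp.2 (by linarith)
        linarith
      · have hz2 : 14 ≤ z := by rw [hz, le_div_iff₀ hk']; linarith
        have : exp (11 * z) ≤ exp (-14 + 12 * z) := exp_le_exp.2 (by linarith)
        split_ifs <;> linarith [exp_pos (154 : ℝ)]
    · have hz2 : z ≤ 8 := by rw [hz, div_le_iff₀ hk']; linarith
      have : exp (11 * z) ≤ exp (8 + 10 * z) := exp_le_exp.2 (by linarith)
      split_ifs <;> linarith [exp_pos (154 : ℝ)]
  have hsum := hlow.trans (sum_le_sum fun v _ => hpt v)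
  rw [sum_add_distrib, sum_add_distrib, ← mul_sum, ← mul_sum, sum_ite_mem, univ_inter, sum_const,
    nsmul_eq_mul] at hsum
  have h25 : exp (-(5 / 2) : ℝ) ≤ 1 / 8 := by
    rw [exp_neg, ← one_div]
    apply one_div_le_one_div_of_le (by norm_num)
    have h := Real.exp_one_gt_d9
    have h2 := add_one_le_exp (1 / 2 : ℝ)
    calc (8 : ℝ) ≤ exp 1 * exp 1 * exp (1 / 2) := by nlinarith [mul_pos (exp_pos 1) (exp_pos 1)]
      _ = exp (5 / 2) := by rw [← exp_add, ← exp_add]; norm_num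
  have a1 : exp 8 * (2 ^ k * exp (10 ^ 2 / 2)) ≤ 2 ^ k * (exp (121 / 2) / 8) := by
    have : exp (8 : ℝ) * exp (10 ^ 2 / 2) = exp (121 / 2) * exp (-(5 / 2)) := by
      rw [← exp_add, ← exp_add]; norm_num
    calc _ = 2 ^ k * (exp (8 : ℝ) * exp (10 ^ 2 / 2)) := by ring
      _ = 2 ^ k * (exp (121 / 2) * exp (-(5 / 2))) := by rw [this]
      _ ≤ 2 ^ k * (exp (121 / 2) * (1 / 8)) := by gcongr
      _ = _ := by ring
  have a2 : exp (-14) * (2 ^ k * exp (12 ^ 2 / 2)) ≤ 2 ^ k * (exp (121 / 2) / 8) := by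
    have : exp (-14 : ℝ) * exp (12 ^ 2 / 2) = exp (121 / 2) * exp (-(5 / 2)) := by
      rw [← exp_add, ← exp_add]; norm_num
    calc _ = 2 ^ k * (exp (-14 : ℝ) * exp (12 ^ 2 / 2)) := by ring
      _ = 2 ^ k * (exp (121 / 2) * exp (-(5 / 2))) := by rw [this]
      _ ≤ 2 ^ k * (exp (121 / 2) * (1 / 8)) := by gcongr
      _ = _ := by ring
  have b1 := mul_le_mul_of_nonneg_left hA (exp_pos 8).le
  have b2 := mul_le_mul_of_nonneg_left hB (exp_pos (-14)).le
  have fin : 2 ^ k * (exp (121 / 2) / 4) ≤ (#W : ℝ) * exp 154 := by linarith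
  have h6 : exp (154 : ℝ) * exp (-154) = 1 := by rw [← exp_add]; norm_num
  calc _ = 2 ^ k * (exp (121 / 2) / 4) * exp (-154) := by ring
    _ ≤ #W * exp 154 * exp (-154) := by gcongr
    _ = #W := by rw [mul_assoc, h6, mul_one]

/-! ### Protocols on rectangles and padded inputs -/

open Finset in
/-- If the weight `w` has sum at most `β` on every combinatorial rectangle, then its sum over the
part of a rectangle on which a protocol of cost `C` outputs `z` is at most `2 ^ C * β`: this part
is a disjoint union of at most `2 ^ C` rectangles. The maps `f` and `g` allow the players to
preprocess their inputs. -/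
lemma sum_run_eq_le {X Y X' Y' : Type*} (f : X' → X) (g : Y' → Y) (w : X' → Y' → ℝ) {β : ℝ}
    (hβ : 0 ≤ β) (hw : ∀ (A : Finset X') (B : Finset Y'), ∑ x ∈ A, ∑ y ∈ B, w x y ≤ β)
    (P : Protocol X Y) (z : Bool) (A : Finset X') (B : Finset Y') :
    ∑ x ∈ A, ∑ y ∈ B, (if P.run (f x) (g y) = z then w x y else 0) ≤ 2 ^ P.cost * β := by
  have hpow : ∀ a b : ℕ, (2 : ℝ) ^ a * β + 2 ^ b * β ≤ 2 ^ (1 + max a b) * β := by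
    intro a b
    have h1 : (2 : ℝ) ^ a ≤ 2 ^ max a b := pow_le_pow_right₀ one_le_two (le_max_left _ _)
    have h2 : (2 : ℝ) ^ b ≤ 2 ^ max a b := pow_le_pow_right₀ one_le_two (le_max_right _ _)
    rw [← add_mul, pow_add, pow_one, two_mul]
    gcongr
  induction P generalizing A B with
  | output b =>
    by_cases h : b = z
    · simpa [Protocol.run, Protocol.cost, h] using hw A B
    · simpa [Protocol.run, Protocol.cost, h] using hβ
  | alice q P₀ P₁ ih₀ ih₁ =>
    refine le_trans (le_of_eq ?_)
      ((add_le_add (ih₀ (A.filter fun x => ¬ q (f x) = true) B)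
        (ih₁ (A.filter fun x => q (f x) = true) B)).trans (hpow _ _))
    rw [add_comm, ← sum_filter_add_sum_filter_not A (fun x => q (f x) = true)]
    congr 1 <;>
    · refine sum_congr rfl fun x hx => sum_congr rfl fun y _ => ?_
      have := (mem_filter.1 hx).2
      simp [Protocol.run, this]
  | bob q P₀ P₁ ih₀ ih₁ =>
    refine le_trans (le_of_eq ?_)
      ((add_le_add (ih₀ A (B.filter fun y => ¬ q (g y) = true))
        (ih₁ A (B.filter fun y => q (g y) = true))).trans (hpow _ _))
    rw [add_comm, ← sum_add_distrib]
    refine sum_congr rfl fun x _ => ?_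
    rw [← sum_filter_add_sum_filter_not B (fun y => q (g y) = true)]
    congr 1 <;>
    · refine sum_congr rfl fun y hy => ?_
      have := (mem_filter.1 hy).2
      simp [Protocol.run, this]

lemma GHD_eq_false {n : ℕ} {x y : Fin n → Bool} (h : 2 * √n ≤ corr x y) :
    GHD n ((n : ℝ) / 2) √n x y = some false := by
  rw [corr_eq_card_sub_hammingDist, Fintype.card_fin] at h
  rw [GHD, if_pos (by linarith)]

lemma GHD_eq_true {n : ℕ} {x y : Fin n → Bool} (h : corr x y < -(2 * √n)) :
    GHD n ((n : ℝ) / 2) √n x y = some true := by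
  rw [corr_eq_card_sub_hammingDist, Fintype.card_fin] at h
  have := Real.sqrt_nonneg (n : ℝ)
  rw [GHD, if_neg (by linarith), if_pos (by linarith)]

/-- The protocol errs on the input `(x, y)` of the Gap-Hamming-Distance problem with threshold
`n / 2` and gap `√n`. -/
def Errs {n : ℕ} (P : Protocol (Fin n → Bool) (Fin n → Bool)) (x y : Fin n → Bool) : Prop :=
  GHD n ((n : ℝ) / 2) √n x y ≠ none ∧ some (P.run x y) ≠ GHD n ((n : ℝ) / 2) √n x y

lemma errs_of_run_eq_true {n : ℕ} {P : Protocol (Fin n → Bool) (Fin n → Bool)}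
    {x y : Fin n → Bool} (h : 2 * √n ≤ corr x y) (hP : P.run x y = true) : Errs P x y := by
  simp [Errs, GHD_eq_false h, hP]

lemma errs_of_run_eq_false {n : ℕ} {P : Protocol (Fin n → Bool) (Fin n → Bool)}
    {x y : Fin n → Bool} (h : corr x y < -(2 * √n)) (hP : P.run x y = false) : Errs P x y := by
  simp [Errs, GHD_eq_true h, hP]

open Classical Finset in
lemma err_eq_card_div {n : ℕ} (P : Protocol (Fin n → Bool) (Fin n → Bool)) :
    P.err (GHD n ((n : ℝ) / 2) √n) (PMF.uniformOfFintype ((Fin n → Bool) × (Fin n → Bool)))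
      = #{p : (Fin n → Bool) × (Fin n → Bool) | Errs P p.1 p.2} / 4 ^ n := by
  rw [Protocol.err, PMF.toOuterMeasure_uniformOfFintype_apply, ENNReal.toReal_div,
    Fintype.card_subtype]
  have h : (4 : ℝ) ^ n = 2 ^ n * 2 ^ n := by rw [← mul_pow]; norm_num
  simp only [Fintype.card_prod, Fintype.card_pi, Fintype.card_bool, prod_const, card_univ,
    Fintype.card_fin, ENNReal.toReal_natCast, Nat.cast_mul, Nat.cast_pow, Nat.cast_ofNat, h,
    Set.mem_ofPred_eq]
  congr 3
  ext p
  simp only [mem_filter, mem_univ, true_and]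
  rfl

open Classical Finset in
/-- Averaging over pads: if an `ε`-fraction of all pairs of strings of length `m + k` has the
property `E`, then any set of pairs of pads with density `α` contains a pair of pads for which the
padded pairs have `E` with density at most `ε / α`. -/
lemma exists_pad {m k : ℕ} {E : (Fin (m + k) → Bool) → (Fin (m + k) → Bool) → Prop} {ε α : ℝ}
    (hα : 0 < α)
    (hE : (#{p : (Fin (m + k) → Bool) × (Fin (m + k) → Bool) | E p.1 p.2} : ℝ) ≤ ε * 4 ^ (m + k))
    (W : Finset ((Fin k → Bool) × (Fin k → Bool))) (hW : α * 4 ^ k ≤ #W) :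
    ∃ w ∈ W, (#{p : (Fin m → Bool) × (Fin m → Bool) |
      E (Fin.append p.1 w.1) (Fin.append p.2 w.2)} : ℝ) ≤ ε / α * 4 ^ m := by
  by_contra! hcon
  have h4 : (0 : ℝ) < 4 ^ k := by positivity
  have hne : W.Nonempty := by
    rw [← card_pos]
    exact_mod_cast (mul_pos hα h4).trans_le hW
  have hcount : ∑ w ∈ W, #{p : (Fin m → Bool) × (Fin m → Bool) |
      E (Fin.append p.1 w.1) (Fin.append p.2 w.2)}
      ≤ #{p : (Fin (m + k) → Bool) × (Fin (m + k) → Bool) | E p.1 p.2} := by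
    rw [← card_sigma]
    refine card_le_card_of_injOn
      (fun s => (Fin.append s.2.1 s.1.1, Fin.append s.2.2 s.1.2)) ?_ ?_
    · intro s hs
      simpa using (mem_filter.1 (mem_sigma.1 hs).2).2
    · rintro ⟨⟨u, v⟩, ⟨x, y⟩⟩ _ ⟨⟨u', v'⟩, ⟨x', y'⟩⟩ _ h
      simp only [Prod.mk.injEq] at h
      have h1 := (Fin.appendEquiv (α := Bool) m k).injective (a₁ := (x, u)) (a₂ := (x', u')) h.1
      have h2 := (Fin.appendEquiv (α := Bool) m k).injective (a₁ := (y, v)) (a₂ := (y', v')) h.2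
      simp_all
  have hlt : ∑ w ∈ W, ε / α * 4 ^ m < ∑ w ∈ W, (#{p : (Fin m → Bool) × (Fin m → Bool) |
      E (Fin.append p.1 w.1) (Fin.append p.2 w.2)} : ℝ) := sum_lt_sum_of_nonempty hne hcon
  rw [sum_const, nsmul_eq_mul] at hlt
  have hcount' := (Nat.cast_le (α := ℝ)).2 hcount
  push_cast at hcount'
  have hε : 0 ≤ ε := by
    by_contra! h
    have : ε * 4 ^ (m + k) < 0 := mul_neg_of_neg_of_pos h (by positivity)
    have h0 : (0 : ℝ) ≤ #{p : (Fin (m + k) → Bool) × (Fin (m + k) → Bool) | E p.1 p.2} := by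
      positivity
    linarith
  have : ε * 4 ^ (m + k) ≤ #W * (ε / α * 4 ^ m) := by
    calc ε * 4 ^ (m + k) = α * 4 ^ k * (ε / α * 4 ^ m) := by
          rw [pow_add]; field_simp
      _ ≤ _ := by gcongr
  linarith

/-- `LargeRectanglesSpread T` says that in sufficiently high dimension `m`, on any rectangle with
exponentially dense sides the correlation exceeds `T√m` in absolute value with probability bounded
away from zero. -/
def LargeRectanglesSpread (T : ℝ) : Prop :=
  ∃ c : ℝ, 0 < c ∧ ∃ δ : ℝ, 0 < δ ∧ ∃ M : ℕ, ∀ m : ℕ, M ≤ m → ∀ A B : Finset (Fin m → Bool),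
    exp (-c * m) * 2 ^ m ≤ A.card → exp (-c * m) * 2 ^ m ≤ B.card →
      δ * (A.card * B.card) ≤ ((A ×ˢ B).filter fun p => T * √m < |corr p.1 p.2|).card

open Classical Finset in
lemma exists_card_corr_window_prod :
    ∃ α : ℝ, 0 < α ∧ ∃ K : ℕ, ∀ k : ℕ, K ≤ k → ∀ s : ℝ, s = 1 ∨ s = -1 →
      α * 4 ^ k ≤ #{p : (Fin k → Bool) × (Fin k → Bool) |
        8 * √k ≤ s * corr p.1 p.2 ∧ s * corr p.1 p.2 ≤ 14 * √k} := by
  obtain ⟨α, hα, K, hK⟩ := exists_card_corr_window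
  refine ⟨α, hα, K, fun k hk s hs => ?_⟩
  have h1 : ∀ u : Fin k → Bool,
      α * 2 ^ k ≤ #{v : Fin k → Bool | 8 * √k ≤ s * corr u v ∧ s * corr u v ≤ 14 * √k} := by
    intro u
    refine (hK k hk u).trans ?_
    rcases hs with rfl | rfl
    · simp
    · norm_cast
      refine card_le_card_of_injOn (fun v j => !v j) ?_ ?_
      · intro v hv
        simpa [corr_not_right] using hv
      · intro v _ v' _ h
        funext j
        simpa using congrFun h j
  have h2 : #{p : (Fin k → Bool) × (Fin k → Bool) |
        8 * √k ≤ s * corr p.1 p.2 ∧ s * corr p.1 p.2 ≤ 14 * √k}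
      = ∑ u : Fin k → Bool, #{v : Fin k → Bool | 8 * √k ≤ s * corr u v ∧
        s * corr u v ≤ 14 * √k} := by
    simp only [card_filter, ← univ_product_univ, sum_product]
  rw [h2]
  push_cast
  calc α * 4 ^ k = ∑ u : Fin k → Bool, α * 2 ^ k := by
        have h : (4 : ℝ) ^ k = 2 ^ k * 2 ^ k := by rw [← mul_pow]; norm_num
        simp [h]
        ring
    _ ≤ _ := sum_le_sum fun u _ => h1 u

open Classical Finset in
/-- If a protocol, run with two different pairs of pads, gives the pair of outputs `(false, true)`
on a constant fraction of all inputs, but only on few inputs of large correlation, then its cost is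
linear. This is `sum_run_eq_le`, applied once for each pair of pads, with the weight `δ` minus the
indicator of large correlation. -/
lemma le_cost_of_run_eq {m k : ℕ} {c δ : ℝ} (hδ : 0 < δ)
    (hrect : ∀ A B : Finset (Fin m → Bool),
      exp (-c * m) * 2 ^ m ≤ #A → exp (-c * m) * 2 ^ m ≤ #B →
        δ * (#A * #B) ≤ #((A ×ˢ B).filter fun p => 36 * √m < |corr p.1 p.2|))
    (P : Protocol (Fin (m + k) → Bool) (Fin (m + k) → Bool))
    (u v u' v' : Fin k → Bool)
    (hnear : (3 / 8 : ℝ) * 4 ^ m ≤ #{p : (Fin m → Bool) × (Fin m → Bool) |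
      P.run (Fin.append p.1 u) (Fin.append p.2 v) = false ∧
      P.run (Fin.append p.1 u') (Fin.append p.2 v') = true})
    (hfar : (#{p : (Fin m → Bool) × (Fin m → Bool) |
      (P.run (Fin.append p.1 u) (Fin.append p.2 v) = false ∧
      P.run (Fin.append p.1 u') (Fin.append p.2 v') = true) ∧
      36 * √m < |corr p.1 p.2|} : ℝ) ≤ δ / 8 * 4 ^ m) :
    c * m ≤ 2 * P.cost + 2 := by
  set w : (Fin m → Bool) → (Fin m → Bool) → ℝ :=
    fun x y => δ - if 36 * √m < |corr x y| then 1 else 0 with hw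
  have h4 : (4 : ℝ) ^ m = 2 ^ m * 2 ^ m := by rw [← mul_pow]; norm_num
  have hcard : ∀ A : Finset (Fin m → Bool), (#A : ℝ) ≤ 2 ^ m := by
    intro A
    have := (Nat.cast_le (α := ℝ)).2 (card_le_univ A)
    simpa using this
  have hβ : 0 ≤ δ * (exp (-c * m) * 4 ^ m) := by positivity
  have hsum : ∀ A B : Finset (Fin m → Bool), ∑ x ∈ A, ∑ y ∈ B, w x y
      = δ * (#A * #B) - #((A ×ˢ B).filter fun p => 36 * √m < |corr p.1 p.2|) := by
    intro A B
    rw [← sum_product', hw]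
    simp only [sum_sub_distrib, sum_const, card_product, sum_boole, nsmul_eq_mul]
    push_cast
    ring
  have hwR : ∀ A B : Finset (Fin m → Bool),
      ∑ x ∈ A, ∑ y ∈ B, w x y ≤ δ * (exp (-c * m) * 4 ^ m) := by
    intro A B
    rw [hsum]
    by_cases hA : exp (-c * m) * 2 ^ m ≤ #A
    · by_cases hB : exp (-c * m) * 2 ^ m ≤ #B
      · linarith [hrect A B hA hB]
      · have : (#A * #B : ℝ) ≤ exp (-c * m) * 4 ^ m := by
          calc (#A * #B : ℝ) ≤ 2 ^ m * (exp (-c * m) * 2 ^ m) := by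
                gcongr
                · exact hcard A
                · exact (not_le.1 hB).le
            _ = _ := by rw [h4]; ring
        have := mul_le_mul_of_nonneg_left this hδ.le
        have h0 : (0 : ℝ) ≤ #((A ×ˢ B).filter fun p => 36 * √m < |corr p.1 p.2|) :=
          Nat.cast_nonneg _
        linarith
    · have : (#A * #B : ℝ) ≤ exp (-c * m) * 4 ^ m := by
        calc (#A * #B : ℝ) ≤ (exp (-c * m) * 2 ^ m) * 2 ^ m := by
              gcongr
              · exact (not_le.1 hA).le
              · exact hcard B
          _ = _ := by rw [h4]; ring
      have := mul_le_mul_of_nonneg_left this hδ.le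
      have h0 : (0 : ℝ) ≤ #((A ×ˢ B).filter fun p => 36 * √m < |corr p.1 p.2|) :=
        Nat.cast_nonneg _
      linarith
  have h1 := sum_run_eq_le (fun x => Fin.append x u') (fun y => Fin.append y v') w hβ hwR P true
  have h2 := sum_run_eq_le (fun x => Fin.append x u) (fun y => Fin.append y v) _
    (by positivity) h1 P false univ univ
  have h3 : ∑ x : Fin m → Bool, ∑ y : Fin m → Bool,
      (if P.run (Fin.append x u) (Fin.append y v) = false then
        (if P.run (Fin.append x u') (Fin.append y v') = true then w x y else 0) else 0)
      = δ * #{p : (Fin m → Bool) × (Fin m → Bool) |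
          P.run (Fin.append p.1 u) (Fin.append p.2 v) = false ∧
          P.run (Fin.append p.1 u') (Fin.append p.2 v') = true}
        - #{p : (Fin m → Bool) × (Fin m → Bool) |
          (P.run (Fin.append p.1 u) (Fin.append p.2 v) = false ∧
          P.run (Fin.append p.1 u') (Fin.append p.2 v') = true) ∧
          36 * √m < |corr p.1 p.2|} := by
    rw [← sum_product', univ_product_univ]
    simp only [← ite_and, hw, ← sum_filter]
    rw [sum_sub_distrib, sum_const, nsmul_eq_mul, sum_boole, filter_filter]
    ring
  rw [h3] at h2
  have h5 : δ * (1 / 4 * 4 ^ m) ≤ δ * (2 ^ P.cost * 2 ^ P.cost * exp (-c * m) * 4 ^ m) := by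
    have := mul_le_mul_of_nonneg_left hnear hδ.le
    linarith
  have h6 : (1 / 4 : ℝ) ≤ 2 ^ P.cost * 2 ^ P.cost * exp (-c * m) :=
    le_of_mul_le_mul_right (le_of_mul_le_mul_left h5 hδ) (by positivity)
  have h7 : (2 : ℝ) ^ P.cost ≤ exp P.cost := by
    have : (2 : ℝ) ≤ exp 1 := by linarith [add_one_le_exp (1 : ℝ)]
    calc (2 : ℝ) ^ P.cost ≤ exp 1 ^ P.cost := by gcongr
      _ = exp P.cost := by rw [← exp_nat_mul, mul_one]
  have h8 : exp (-2 : ℝ) ≤ 1 / 4 := exp_neg_two_le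
  have h9 : exp (-2 : ℝ) ≤ exp (P.cost + P.cost + -c * m) := by
    rw [exp_add, exp_add]
    refine (h8.trans h6).trans ?_
    gcongr
  have := exp_le_exp.1 h9
  linarith

open Classical Finset in
/-- The pads that turn a protocol for the Gap-Hamming-Distance problem into a test for small
correlation: outputs on both padded inputs are `false` and `true` for pairs of small correlation,
up to errors of the protocol, and this happens for pairs of large correlation only through errors
of the protocol. -/
lemma exists_pads_of_err {m k : ℕ} (hm : 0 < m) (hmk : m ≤ k) (hkm : k ≤ 2 * m) {α δ ε : ℝ}
    (hα : 0 < α) (hδ1 : δ ≤ 1) (hε : ε / α = δ / 16)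
    (hwin : ∀ s : ℝ, s = 1 ∨ s = -1 →
      α * 4 ^ k ≤ #{p : (Fin k → Bool) × (Fin k → Bool) |
        8 * √k ≤ s * corr p.1 p.2 ∧ s * corr p.1 p.2 ≤ 14 * √k})
    (P : Protocol (Fin (m + k) → Bool) (Fin (m + k) → Bool))
    (hP : (#{p : (Fin (m + k) → Bool) × (Fin (m + k) → Bool) | Errs P p.1 p.2} : ℝ)
      ≤ ε * 4 ^ (m + k)) :
    ∃ u v u' v' : Fin k → Bool,
      (3 / 8 : ℝ) * 4 ^ m ≤ #{p : (Fin m → Bool) × (Fin m → Bool) |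
        P.run (Fin.append p.1 u) (Fin.append p.2 v) = false ∧
        P.run (Fin.append p.1 u') (Fin.append p.2 v') = true} ∧
      (#{p : (Fin m → Bool) × (Fin m → Bool) |
        (P.run (Fin.append p.1 u) (Fin.append p.2 v) = false ∧
        P.run (Fin.append p.1 u') (Fin.append p.2 v') = true) ∧
        36 * √m < |corr p.1 p.2|} : ℝ) ≤ δ / 8 * 4 ^ m := by
  obtain ⟨⟨u, v⟩, hw, he⟩ := exists_pad hα hP _ (hwin 1 (Or.inl rfl))
  obtain ⟨⟨u', v'⟩, hw', he'⟩ := exists_pad hα hP _ (hwin (-1) (Or.inr rfl))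
  simp only [mem_filter, mem_univ, true_and] at hw hw' he he'
  rw [hε] at he he'
  refine ⟨u, v, u', v', ?_⟩
  have hs0 : 0 < √(m : ℝ) := by positivity
  have hmk' : √(m : ℝ) ≤ √(k : ℝ) := Real.sqrt_le_sqrt (by exact_mod_cast hmk)
  have hn2 : √((m + k : ℕ) : ℝ) ≤ 2 * √(m : ℝ) := by
    rw [Real.sqrt_le_left (by positivity), mul_pow, Real.sq_sqrt (by positivity)]
    have : ((m + k : ℕ) : ℝ) ≤ 3 * m := by exact_mod_cast (by omega : m + k ≤ 3 * m)
    have : (0 : ℝ) ≤ m := by positivity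
    linarith
  have hnk : 2 * √((m + k : ℕ) : ℝ) ≤ 3 * √(k : ℝ) := by
    have h : √((m + k : ℕ) : ℝ) ≤ 3 / 2 * √(k : ℝ) := by
      rw [Real.sqrt_le_left (by positivity), mul_pow, Real.sq_sqrt (by positivity)]
      have : ((m + k : ℕ) : ℝ) ≤ 2 * k := by exact_mod_cast (by omega : m + k ≤ 2 * k)
      have : (0 : ℝ) ≤ k := by positivity
      linarith
    linarith
  have hk32 : √(k : ℝ) ≤ 3 / 2 * √(m : ℝ) := by
    rw [Real.sqrt_le_left (by positivity), mul_pow, Real.sq_sqrt (by positivity)]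
    have : (k : ℝ) ≤ 2 * m := by exact_mod_cast hkm
    have : (0 : ℝ) ≤ m := by positivity
    linarith
  set E : Finset ((Fin m → Bool) × (Fin m → Bool)) :=
    {p | Errs P (Fin.append p.1 u) (Fin.append p.2 v)} with hE
  set E' : Finset ((Fin m → Bool) × (Fin m → Bool)) :=
    {p | Errs P (Fin.append p.1 u') (Fin.append p.2 v')} with hE'
  set Z : Finset ((Fin m → Bool) × (Fin m → Bool)) :=
    {p | P.run (Fin.append p.1 u) (Fin.append p.2 v) = false ∧
        P.run (Fin.append p.1 u') (Fin.append p.2 v') = true} with hZ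
  have hEE : (#(E ∪ E') : ℝ) ≤ δ / 8 * 4 ^ m := by
    have := (Nat.cast_le (α := ℝ)).2 (card_union_le E E')
    push_cast at this
    linarith
  constructor
  · have hN : (1 / 2 : ℝ) * 4 ^ m
        ≤ #{p : (Fin m → Bool) × (Fin m → Bool) | |corr p.1 p.2| ≤ 2 * √m} := by
      have h2 : #{p : (Fin m → Bool) × (Fin m → Bool) | |corr p.1 p.2| ≤ 2 * √m}
          = ∑ x : Fin m → Bool, #{y : Fin m → Bool | |corr x y| ≤ 2 * √m} := by
        simp only [card_filter, ← univ_product_univ, sum_product]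
      rw [h2]
      push_cast
      calc (1 / 2 : ℝ) * 4 ^ m = ∑ x : Fin m → Bool, (2 : ℝ) ^ m / 2 := by
            have h : (4 : ℝ) ^ m = 2 ^ m * 2 ^ m := by rw [← mul_pow]; norm_num
            simp [h]
            ring
        _ ≤ _ := sum_le_sum fun x _ => card_abs_corr_le m hm x
    have hsub : ({p | |corr p.1 p.2| ≤ 2 * √m} : Finset ((Fin m → Bool) × (Fin m → Bool)))
        ⊆ Z ∪ (E ∪ E') := by
      intro p hp
      have hp := abs_le.1 (mem_filter.1 hp).2
      simp only [mem_union, hZ, hE, hE', mem_filter, mem_univ, true_and]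
      by_contra! hcon
      obtain ⟨h1, h2, h3⟩ := hcon
      have r1 : P.run (Fin.append p.1 u) (Fin.append p.2 v) = false := by
        by_contra hr
        refine h2 (errs_of_run_eq_true ?_ (by simpa using hr))
        rw [corr_append]
        linarith
      refine h3 (errs_of_run_eq_false ?_ (by simpa using h1 r1))
      rw [corr_append]
      linarith
    have h5 := (Nat.cast_le (α := ℝ)).2 ((card_le_card hsub).trans (card_union_le _ _))
    push_cast at h5
    have h6 : δ / 8 * 4 ^ m ≤ 1 / 8 * (4 : ℝ) ^ m := by gcongr
    linarith
  · refine le_trans (Nat.cast_le.2 (card_le_card ?_)) hEE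
    intro p hp
    simp only [mem_filter, mem_univ, true_and] at hp
    obtain ⟨⟨r1, r2⟩, hc⟩ := hp
    simp only [mem_union, hE, hE', mem_filter, mem_univ, true_and]
    rcases lt_abs.1 hc with h | h
    · right
      refine errs_of_run_eq_true ?_ r2
      rw [corr_append]
      linarith
    · left
      refine errs_of_run_eq_false ?_ r1
      rw [corr_append]
      linarith

/-- Linear lower bound for Gap-Hamming-Distance from the spread of the correlation on large
rectangles. -/
lemma distComplexity_of_spread (h : LargeRectanglesSpread 36) :
    ∃ ε : ℝ, 0 < ε ∧ ∃ c : ℝ, 0 < c ∧ ∃ N : ℕ, ∀ n : ℕ, N ≤ n →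
      c * (n : ℝ) ≤
        (CommComplexity.distComplexity
          (CommComplexity.GHD n ((n : ℝ) / 2) (Real.sqrt (n : ℝ)))
          (PMF.uniformOfFintype ((Fin n → Bool) × (Fin n → Bool))) ε : ℝ) := by
  obtain ⟨c, hc, δ₀, hδ₀, M, hM⟩ := h
  obtain ⟨α, hα, K, hK⟩ := exists_card_corr_window_prod
  set δ := min δ₀ 1 with hδ
  have hδ0 : 0 < δ := lt_min hδ₀ one_pos
  have hδ1 : δ ≤ 1 := min_le_right _ _
  refine ⟨α * δ / 16, by positivity, c / 16, by positivity,
    2 * M + 2 * K + 4 + ⌈16 / c⌉₊, fun n hn => ?_⟩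
  obtain ⟨m, k, rfl, hmk, hkm, hMm, hKk, hm⟩ : ∃ m k, n = m + k ∧ m ≤ k ∧ k ≤ 2 * m ∧
      M ≤ m ∧ K ≤ k ∧ 0 < m :=
    ⟨n / 2, n - n / 2, by omega, by omega, by omega, by omega, by omega, by omega⟩
  obtain ⟨P, hP, hcost⟩ := exists_cost_eq_distComplexity
    (GHD (m + k) (((m + k : ℕ) : ℝ) / 2) √((m + k : ℕ) : ℝ))
    (PMF.uniformOfFintype ((Fin (m + k) → Bool) × (Fin (m + k) → Bool)))
    (ε := α * δ / 16) (by positivity)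
  rw [← hcost]
  rw [err_eq_card_div, div_le_iff₀ (by positivity)] at hP
  obtain ⟨u, v, u', v', hnear, hfar⟩ := exists_pads_of_err hm hmk hkm hα hδ1
    (by field_simp) (hK k hKk) P hP
  have key := le_cost_of_run_eq hδ0 (fun A B hA hB =>
    le_trans (mul_le_mul_of_nonneg_right (min_le_left _ _) (by positivity)) (hM m hMm A B hA hB))
    P u v u' v' hnear hfar
  have hnc : 16 ≤ c * ((m + k : ℕ) : ℝ) := by
    have h1 : 16 / c ≤ ((m + k : ℕ) : ℝ) :=
      (Nat.le_ceil _).trans (by exact_mod_cast (by omega : ⌈16 / c⌉₊ ≤ m + k))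
    rwa [div_le_iff₀' hc] at h1
  have h3 : ((m + k : ℕ) : ℝ) ≤ 3 * m := by exact_mod_cast (by omega : m + k ≤ 3 * m)
  have h4 := mul_le_mul_of_nonneg_left h3 hc.le
  linarith

/-! ### One-dimensional Gaussian estimates -/

/-- The law of `|g|` for a standard Gaussian `g` is strictly sub-Gaussian near the origin: its
centred moment generating function is at most `exp (v s² / 2)` with some `v < 1`. The reason is
that its variance is `1 - (E |g|)² < 1`. -/
lemma exists_mgf_abs_gaussian_le :
    ∃ μ₀ v s₀ : ℝ, 0 ≤ μ₀ ∧ μ₀ ≤ 1 ∧ 0 < v ∧ v < 1 ∧ 0 < s₀ ∧ ∀ s : ℝ, |s| ≤ s₀ →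
      ∫ g, exp (s * |g|) ∂(gaussianReal 0 1) ≤ exp (s * μ₀ + v * s ^ 2 / 2) := by
  set γ := gaussianReal 0 1 with hγ
  set X : ℝ → ℝ := fun g => |g| with hX
  have hint : ∀ t, Integrable (fun g => exp (t * X g)) γ := fun t =>
    integrable_exp_mul_abs (by simpa using integrable_exp_mul_gaussianReal t)
      (by simpa using integrable_exp_mul_gaussianReal (-t))
  have huniv : integrableExpSet X γ = Set.univ := Set.eq_univ_of_forall hint
  have hmem : ∀ t, t ∈ interior (integrableExpSet X γ) := by simp [huniv]
  have hId : MemLp (fun g : ℝ => g) 2 γ := memLp_id_gaussianReal 2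
  have hXL : MemLp X 2 γ := hId.abs
  set μ₀ := γ[X] with hμ₀
  have hX2 : γ[X ^ 2] = 1 := by
    have h1 := variance_eq_sub hId
    have h2 : Var[fun g : ℝ => g; γ] = 1 := by simp [hγ]
    have h3 : ∫ g, g ∂γ = 0 := by simp [hγ]
    rw [h2, h3] at h1
    have h4 : X ^ 2 = (fun g : ℝ => g) ^ 2 := by funext g; simp [hX]
    rw [h4]
    linarith
  have hvar : Var[X; γ] = 1 - μ₀ ^ 2 := by rw [variance_eq_sub hXL, hX2]
  have hμ0 : 0 < μ₀ := by
    have h0 : 0 ≤ μ₀ := integral_nonneg fun g => abs_nonneg g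
    refine lt_of_le_of_ne h0 fun h => ?_
    have h1 := (integral_eq_zero_iff_of_nonneg (fun g => abs_nonneg g)
      (hXL.integrable one_le_two)).1 h.symm
    have h2 : ∀ᵐ g ∂γ, X g ^ 2 = 0 := by
      filter_upwards [h1] with g hg
      have : X g = 0 := hg
      rw [this]
      simp
    have h3 : γ[X ^ 2] = 0 := integral_eq_zero_of_ae h2
    linarith
  have hμ1 : μ₀ ≤ 1 := by
    have := variance_nonneg X γ
    nlinarith
  set v := 1 - μ₀ ^ 2 / 2 with hv
  have hv0 : 0 < v := by nlinarith
  have hv1 : v < 1 := by nlinarith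
  -- `f'(0) = 0` and `f''(0) = Var |g| - v < 0`, hence `f ≤ f 0 = 0` near the origin.
  set f : ℝ → ℝ := fun s => cgf X γ s - (s * μ₀ + v * s ^ 2 / 2) with hf
  have hcd : ∀ t, DifferentiableAt ℝ (cgf X γ) t := fun t => (analyticAt_cgf (hmem t)).differentiableAt
  have hpd : ∀ t, HasDerivAt (fun s : ℝ => s * μ₀ + v * s ^ 2 / 2) (μ₀ + v * t) t := by
    intro t
    have h1 := ((hasDerivAt_id t).mul_const μ₀).add
      (((hasDerivAt_pow 2 t).const_mul v).div_const 2)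
    refine h1.congr_deriv ?_
    simp
    ring
  have hderiv : deriv f = fun t => deriv (cgf X γ) t - (μ₀ + v * t) := by
    funext t
    exact ((hcd t).hasDerivAt.sub (hpd t)).deriv
  have hd0 : deriv (cgf X γ) 0 = μ₀ := by
    rw [deriv_cgf_zero (hmem 0)]
    simp [hμ₀]
  have hd2 : deriv (deriv (cgf X γ)) 0 = 1 - μ₀ ^ 2 := by
    have h := iteratedDeriv_two_cgf (hmem 0)
    rw [iteratedDeriv_succ, iteratedDeriv_one, hd0] at h
    rw [h]
    simp only [zero_mul, exp_zero, mul_one, mgf_zero]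
    have : ∫ g, X g ^ 2 ∂γ = 1 := hX2
    rw [this]
    simp
  have hdd : deriv (deriv f) 0 < 0 := by
    rw [hderiv]
    have h1 : HasDerivAt (fun t : ℝ => μ₀ + v * t) v 0 := by
      simpa using ((hasDerivAt_id (0 : ℝ)).const_mul v).const_add μ₀
    have h2 := ((analyticAt_cgf (hmem 0)).deriv.differentiableAt.hasDerivAt.sub h1).deriv
    have h3 : deriv (fun t => deriv (cgf X γ) t - (μ₀ + v * t)) 0 = 1 - μ₀ ^ 2 - v := by
      rw [← hd2]; exact h2
    rw [h3, hv]
    nlinarith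
  have hmax : IsLocalMax f 0 := isLocalMax_of_deriv_deriv_neg hdd (by simp [hderiv, hd0])
    ((hcd 0).sub (hpd 0).differentiableAt).continuousAt
  have hf0 : f 0 = 0 := by simp [hf]
  obtain ⟨s₀, hs₀, hball⟩ := Metric.eventually_nhds_iff.1 hmax
  refine ⟨μ₀, v, s₀ / 2, hμ0.le, hμ1, hv0, hv1, by positivity, fun s hs => ?_⟩
  have h1 : f s ≤ 0 := by
    rw [← hf0]
    refine hball ?_
    rw [Real.dist_eq, sub_zero]
    linarith
  have h2 : ∫ g, exp (s * |g|) ∂γ = exp (cgf X γ s) := (exp_cgf (hint s)).symm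
  rw [h2]
  apply exp_le_exp.2
  simp only [hf] at h1
  linarith

lemma gaussianReal_Ioi_ge {t : ℝ} (ht : 0 ≤ t) :
    (√(2 * π))⁻¹ * exp (-(t + 1) ^ 2 / 2) ≤ (gaussianReal 0 1).real (Set.Ioi t) := by
  have h1 : (gaussianReal 0 1).real (Set.Ioc t (t + 1)) ≤ (gaussianReal 0 1).real (Set.Ioi t) :=
    measureReal_mono Set.Ioc_subset_Ioi_self
  refine le_trans ?_ h1
  rw [measureReal_def, gaussianReal_apply_eq_integral _ one_ne_zero,
    ENNReal.toReal_ofReal (integral_nonneg fun x => gaussianPDFReal_nonneg _ _ _)]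
  calc (√(2 * π))⁻¹ * exp (-(t + 1) ^ 2 / 2)
      = ∫ x in Set.Ioc t (t + 1), (√(2 * π))⁻¹ * exp (-(t + 1) ^ 2 / 2) := by simp
    _ ≤ ∫ x in Set.Ioc t (t + 1), gaussianPDFReal 0 1 x := by
        refine setIntegral_mono_on (integrableOn_const (by simp)) ((integrable_gaussianPDFReal 0 1).integrableOn)
          measurableSet_Ioc fun x hx => ?_
        rw [gaussianPDFReal]
        simp only [NNReal.coe_one, mul_one, sub_zero]
        gcongr
        · linarith [hx.1]
        · exact hx.2

/-- Since `√v < σ`, at a high enough threshold `T'` the sub-Gaussian tail with variance proxy `v`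
is much smaller than the tail of a Gaussian with standard deviation `σ`. -/
lemma exists_threshold {T v σ : ℝ} (hT : 0 ≤ T) (hv : 0 < v) (hσ : √v < σ) :
    ∃ T', T ≤ T' ∧ 8 * (2 * exp (-(T' - T) ^ 2 / (2 * v)))
      ≤ (gaussianReal 0 1).real (Set.Ioi (T' / σ)) := by
  have hv' : 0 < √v := Real.sqrt_pos.2 hv
  have hσ0 : 0 < σ := hv'.trans hσ
  have hd : 0 < 1 / √v - 1 / σ := sub_pos.2 (one_div_lt_one_div_of_lt hv' hσ)
  set T' := T + (4 + T / σ) / (1 / √v - 1 / σ) with hT'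
  have hTT' : T ≤ T' := by
    have : 0 ≤ (4 + T / σ) / (1 / √v - 1 / σ) := by positivity
    linarith
  refine ⟨T', hTT', le_trans ?_ (gaussianReal_Ioi_ge (div_nonneg (hT.trans hTT') hσ0.le))⟩
  set a := (T' - T) / √v with ha
  set b := T' / σ + 1 with hb
  have hab : a = b + 3 := by
    have h1 : (T' - T) * (1 / √v - 1 / σ) = 4 + T / σ := by
      rw [hT', add_sub_cancel_left, div_mul_cancel₀ _ hd.ne']
    have h2 : (T' - T) * (1 / √v - 1 / σ) = a - (b - 1) + T / σ := by
      rw [ha, hb]; ring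
    linarith
  have hb0 : 0 ≤ b := by
    have : 0 ≤ T' / σ := div_nonneg (hT.trans hTT') hσ0.le
    linarith
  have e1 : -(T' - T) ^ 2 / (2 * v) = -a ^ 2 / 2 := by
    rw [ha, div_pow, Real.sq_sqrt hv.le]
    field_simp
  have e2 : exp (-a ^ 2 / 2) ≤ exp (-b ^ 2 / 2) * exp (-(9 / 2)) := by
    rw [← exp_add]
    apply exp_le_exp.2
    rw [hab]
    nlinarith
  have h3 : √(2 * π) ≤ 3 := by
    rw [Real.sqrt_le_left (by norm_num)]
    linarith [Real.pi_lt_four]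
  have h48 : exp (-(9 / 2) : ℝ) ≤ 1 / 48 := by
    rw [exp_neg, ← one_div]
    apply one_div_le_one_div_of_le (by norm_num)
    have h := Real.exp_one_gt_d9
    have h2 : (7 : ℝ) ≤ exp 1 * exp 1 := by nlinarith
    calc (48 : ℝ) ≤ (exp 1 * exp 1) * (exp 1 * exp 1) := by nlinarith
      _ = exp 4 := by rw [← exp_add, ← exp_add]; norm_num
      _ ≤ exp (9 / 2) := exp_le_exp.2 (by norm_num)
  have h13 : (1 / 3 : ℝ) ≤ (√(2 * π))⁻¹ := by
    rw [← one_div]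
    exact one_div_le_one_div_of_le (by positivity) h3
  rw [e1]
  calc 8 * (2 * exp (-a ^ 2 / 2)) ≤ 8 * (2 * (exp (-b ^ 2 / 2) * (1 / 48))) := by
        gcongr
        exact e2.trans (by gcongr)
    _ = 1 / 3 * exp (-b ^ 2 / 2) := by ring
    _ ≤ _ := by gcongr

section Cube

variable {m : ℕ}

/-! ### Projections of sign vectors -/

/-- The vector of signs of a bit string, in Euclidean space. -/
noncomputable def cubeVec (x : Fin m → Bool) : EuclideanSpace ℝ (Fin m) :=
  WithLp.toLp 2 fun j => sgn (x j)

lemma norm_cubeVec_sq (x : Fin m → Bool) : ‖cubeVec x‖ ^ 2 = m := by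
  rw [EuclideanSpace.norm_sq_eq]
  simp [cubeVec, abs_sgn]

lemma inner_cubeVec (x : Fin m → Bool) (w : EuclideanSpace ℝ (Fin m)) :
    ⟪cubeVec x, w⟫ = ∑ j, w j * sgn (x j) := by
  simp [cubeVec, PiLp.inner_apply]

open Finset in
lemma sum_exp_inner_cubeVec_le (w : EuclideanSpace ℝ (Fin m)) :
    ∑ y : Fin m → Bool, exp ⟪cubeVec y, w⟫ ≤ 2 ^ m * exp (‖w‖ ^ 2 / 2) := by
  simp only [inner_cubeVec]
  rw [sum_exp_sum_sgn, EuclideanSpace.norm_sq_eq, sum_div, exp_sum, prod_mul_distrib, prod_const,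
    card_univ, Fintype.card_fin]
  gcongr with j
  rw [Real.norm_eq_abs, sq_abs]
  exact cosh_le_exp_half_sq _

/-- Exponential moments of the squared length of the projection of a random sign vector to a
subspace: linearize the square by a Gaussian variable in the subspace and use that sign vectors
are sub-Gaussian. -/
lemma exists_sum_exp_norm_starProjection_sq_le :
    ∃ a : ℝ, 0 < a ∧ ∃ K : ℝ, 1 ≤ K ∧ ∀ (m : ℕ) (V : Submodule ℝ (EuclideanSpace ℝ (Fin m))),
      ∑ y : Fin m → Bool, exp (a * ‖V.starProjection (cubeVec y)‖ ^ 2)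
        ≤ 2 ^ m * K ^ Module.finrank ℝ V := by
  obtain ⟨a, ha, hint⟩ := IsGaussian.exists_integrable_exp_sq (gaussianReal 0 1)
  refine ⟨a, ha, ∫ g, exp (a * ‖g‖ ^ 2) ∂(gaussianReal 0 1), ?_, fun m V => ?_⟩
  · calc (1 : ℝ) = ∫ _, 1 ∂(gaussianReal 0 1) := by simp
      _ ≤ _ := integral_mono (integrable_const _) hint fun g => one_le_exp (by positivity)
  set d := Module.finrank ℝ V
  let b : OrthonormalBasis (Fin d) ℝ V := stdOrthonormalBasis ℝ V
  set γ := Measure.pi fun _ : Fin d => gaussianReal 0 1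
  have hsq : √(2 * a) ^ 2 = 2 * a := Real.sq_sqrt (by positivity)
  have hmgf : ∀ t : ℝ, ∫ g, exp (t * g) ∂(gaussianReal 0 1) = exp (t ^ 2 / 2) := by
    intro t
    have := congrFun (mgf_id_gaussianReal (μ := 0) (v := 1)) t
    simpa [mgf] using this
  have hnorm : ∀ y : Fin m → Bool, ‖V.starProjection (cubeVec y)‖ ^ 2
      = ∑ l, ⟪cubeVec y, (b l : EuclideanSpace ℝ (Fin m))⟫ ^ 2 := by
    intro y
    have h1 := b.sum_sq_norm_inner_right (V.orthogonalProjectionOnto (cubeVec y))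
    have h2 : ‖V.starProjection (cubeVec y)‖ = ‖V.orthogonalProjectionOnto (cubeVec y)‖ := rfl
    rw [h2, ← h1]
    refine Finset.sum_congr rfl fun l _ => ?_
    rw [Real.norm_eq_abs, sq_abs, Submodule.inner_orthogonalProjectionOnto_eq_of_mem_left,
      real_inner_comm]
  have hlin : ∀ y : Fin m → Bool, exp (a * ‖V.starProjection (cubeVec y)‖ ^ 2)
      = ∫ g, exp ⟪cubeVec y, √(2 * a) • ∑ l, g l • (b l : EuclideanSpace ℝ (Fin m))⟫ ∂γ := by
    intro y
    have h1 : ∀ g : Fin d → ℝ,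
        exp ⟪cubeVec y, √(2 * a) • ∑ l, g l • (b l : EuclideanSpace ℝ (Fin m))⟫
        = ∏ l, exp (√(2 * a) * ⟪cubeVec y, (b l : EuclideanSpace ℝ (Fin m))⟫ * g l) := by
      intro g
      rw [← exp_sum, inner_smul_right, inner_sum, Finset.mul_sum]
      congr 1
      refine Finset.sum_congr rfl fun l _ => ?_
      rw [inner_smul_right]
      ring
    simp only [h1]
    rw [integral_fintype_prod_eq_prod (𝕜 := ℝ) (fun l g =>
      exp (√(2 * a) * ⟪cubeVec y, (b l : EuclideanSpace ℝ (Fin m))⟫ * g))]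
    simp only [hmgf]
    rw [← exp_sum, hnorm, Finset.mul_sum]
    congr 1
    refine Finset.sum_congr rfl fun l _ => ?_
    rw [mul_pow, hsq]
    ring
  have hint1 : ∀ y : Fin m → Bool, Integrable (fun g : Fin d → ℝ =>
      exp ⟪cubeVec y, √(2 * a) • ∑ l, g l • (b l : EuclideanSpace ℝ (Fin m))⟫) γ := by
    intro y
    refine Integrable.of_integral_ne_zero ?_
    rw [← hlin y]
    exact (exp_pos _).ne'
  have hwn : ∀ g : Fin d → ℝ,
      ‖√(2 * a) • ∑ l, g l • (b l : EuclideanSpace ℝ (Fin m))‖ ^ 2 / 2 = ∑ l, a * ‖g l‖ ^ 2 := by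
    intro g
    have h1 : ‖∑ l, g l • (b l : EuclideanSpace ℝ (Fin m))‖ ^ 2 = ∑ l, g l ^ 2 := by
      have h2 : Orthonormal ℝ fun l => (b l : EuclideanSpace ℝ (Fin m)) :=
        b.orthonormal.comp_linearIsometry V.subtypeₗᵢ
      rw [← real_inner_self_eq_norm_sq, h2.inner_sum]
      simp [sq]
    rw [norm_smul, mul_pow, h1, Real.norm_eq_abs, sq_abs, hsq, ← Finset.mul_sum]
    simp only [Real.norm_eq_abs, sq_abs]
    ring
  calc ∑ y : Fin m → Bool, exp (a * ‖V.starProjection (cubeVec y)‖ ^ 2)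
      = ∫ g, ∑ y : Fin m → Bool,
        exp ⟪cubeVec y, √(2 * a) • ∑ l, g l • (b l : EuclideanSpace ℝ (Fin m))⟫ ∂γ := by
        rw [integral_finsetSum _ fun y _ => hint1 y]
        exact Finset.sum_congr rfl fun y _ => hlin y
    _ ≤ ∫ g, 2 ^ m * ∏ l, exp (a * ‖g l‖ ^ 2) ∂γ := by
        refine integral_mono (integrable_finsetSum _ fun y _ => hint1 y)
          ((Integrable.fintype_prod fun _ => hint).const_mul _) fun g => ?_
        have := sum_exp_inner_cubeVec_le (√(2 * a) • ∑ l, g l • (b l : EuclideanSpace ℝ (Fin m)))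
        rwa [hwn, exp_sum] at this
    _ = _ := by
        rw [integral_const_mul, integral_fintype_prod_eq_pow (𝕜 := ℝ) fun g => exp (a * ‖g‖ ^ 2),
          Fintype.card_fin]

end Cube

/-! ### Orthogonal components of a Gaussian vector -/

section Independence

variable {E : Type*} [NormedAddCommGroup E] [InnerProductSpace ℝ E] [FiniteDimensional ℝ E]
  [MeasurableSpace E] [BorelSpace E]

lemma map_inner_stdGaussian (r : E) :
    (stdGaussian E).map (fun G => ⟪r, G⟫) = gaussianReal 0 (‖r‖ ^ 2).toNNReal := by
  have h := IsGaussian.map_eq_gaussianReal (μ := stdGaussian E) (innerSL ℝ r)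
  rw [integral_strongDual_stdGaussian, variance_dual_stdGaussian, innerSL_apply_norm] at h
  exact h

/-- The projections of a standard Gaussian vector to a subspace and to its orthogonal complement
are independent. -/
lemma indepFun_starProjection (V : Submodule ℝ E) :
    IndepFun (fun G => V.starProjection G) (fun G => G - V.starProjection G) (stdGaussian E) := by
  have hid : HasGaussianLaw (id : E → E) (stdGaussian E) := IsGaussian.hasGaussianLaw_id
  refine HasGaussianLaw.indepFun_of_covariance_inner
    (hid.map_fun (V.starProjection.prod (ContinuousLinearMap.id ℝ E - V.starProjection)))
    fun x y => ?_
  have h1 : (fun G => ⟪x, V.starProjection G⟫) = fun G => ⟪V.starProjection x, G⟫ := by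
    funext G
    rw [Submodule.inner_starProjection_left_eq_right]
  have h2 : (fun G => ⟪y, G - V.starProjection G⟫) = fun G => ⟪y - V.starProjection y, G⟫ := by
    funext G
    rw [inner_sub_right, inner_sub_left, Submodule.inner_starProjection_left_eq_right]
  rw [h1, h2, ← covarianceBilin_apply_eq_cov IsGaussian.memLp_two_id, covarianceBilin_stdGaussian]
  change ⟪V.starProjection x, y - V.starProjection y⟫ = 0
  rw [real_inner_comm]
  exact V.starProjection_inner_eq_zero y _ (V.starProjection_apply_mem x)

/-- One step of the product bound: given the projection of `G` to `V`, the variable `⟪y, G⟫` is a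
shift of `⟪r, G⟫`, where `r` is the component of `y` orthogonal to `V`. -/
lemma lintegral_mul_le_of_shift_le (V : Submodule ℝ E) {F : E → ℝ≥0∞} (hF : Measurable F)
    (hFV : ∀ G, F (V.starProjection G) = F G) {f : ℝ → ℝ≥0∞} (hf : Measurable f) (y : E)
    {q : ℝ≥0∞}
    (hq : ∀ a : ℝ, ∫⁻ G, f (a + ⟪y - V.starProjection y, G⟫) ∂(stdGaussian E) ≤ q) :
    ∫⁻ G, F G * f ⟪y, G⟫ ∂(stdGaussian E) ≤ q * ∫⁻ G, F G ∂(stdGaussian E) := by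
  set γ := stdGaussian E
  set r := y - V.starProjection y with hr
  have hP : Measurable fun G : E => V.starProjection G := V.starProjection.continuous.measurable
  have hR : Measurable fun G : E => ⟪r, G⟫ := (innerSL ℝ r).continuous.measurable
  have hind : IndepFun (fun G => V.starProjection G) (fun G => ⟪r, G⟫) γ := by
    have h : IndepFun (fun G => V.starProjection G) (fun G => ⟪r, G - V.starProjection G⟫) γ :=
      (indepFun_starProjection V).comp measurable_id hR
    have h0 : ∀ G, ⟪r, V.starProjection G⟫ = 0 := fun G =>
      V.starProjection_inner_eq_zero y _ (V.starProjection_apply_mem G)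
    simpa only [inner_sub_right, h0, sub_zero] using h
  have hmap := (indepFun_iff_map_prod_eq_prod_map_map hP.aemeasurable hR.aemeasurable).1 hind
  have hmeasy : Measurable fun u : E => ⟪y, u⟫ := (innerSL ℝ y).continuous.measurable
  have hΦ : Measurable fun p : E × ℝ => F p.1 * f (⟪y, p.1⟫ + p.2) := by
    exact (hF.comp measurable_fst).mul (hf.comp ((hmeasy.comp measurable_fst).add measurable_snd))
  calc ∫⁻ G, F G * f ⟪y, G⟫ ∂γ
      = ∫⁻ G, F (V.starProjection G) * f (⟪y, V.starProjection G⟫ + ⟪r, G⟫) ∂γ := by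
        refine lintegral_congr fun G => ?_
        rw [hFV, hr, inner_sub_left, Submodule.inner_starProjection_left_eq_right]
        simp
    _ = ∫⁻ p, F p.1 * f (⟪y, p.1⟫ + p.2)
          ∂(γ.map fun G => (V.starProjection G, ⟪r, G⟫)) := by
        rw [lintegral_map hΦ (hP.prodMk hR)]
    _ = ∫⁻ u, ∫⁻ t, F u * f (⟪y, u⟫ + t) ∂(γ.map fun G => ⟪r, G⟫)
          ∂(γ.map fun G => V.starProjection G) := by
        rw [hmap, lintegral_prod _ hΦ.aemeasurable]
    _ ≤ ∫⁻ u, q * F u ∂(γ.map fun G => V.starProjection G) := by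
        refine lintegral_mono fun u => ?_
        have hfu : Measurable fun t => f (⟪y, u⟫ + t) := hf.comp (measurable_const_add _)
        rw [lintegral_const_mul _ hfu, mul_comm, lintegral_map hfu hR]
        gcongr
        exact hq _
    _ = q * ∫⁻ G, F G ∂γ := by
        rw [lintegral_const_mul _ hF, lintegral_map hF hP]
        simp only [hFV]

end Independence

section Signs

variable {m : ℕ}

/-! ### Gaussian vectors with prescribed signs -/

/-- The law of `m` independent standard Gaussian variables. -/
noncomputable abbrev gaussianPi (m : ℕ) : Measure (Fin m → ℝ) :=
  Measure.pi fun _ => gaussianReal 0 1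

/-- The vector with the signs of the bit string `x` and the absolute values of `g`. -/
noncomputable def signed (x : Fin m → Bool) (g : Fin m → ℝ) : EuclideanSpace ℝ (Fin m) :=
  WithLp.toLp 2 fun j => sgn (x j) * |g j|

lemma measurable_signed (x : Fin m → Bool) : Measurable (signed x) := by
  unfold signed
  fun_prop

lemma inner_cubeVec_signed (x y : Fin m → Bool) (g : Fin m → ℝ) :
    ⟪cubeVec y, signed x g⟫ = ∑ j, sgn (x j) * sgn (y j) * |g j| := by
  rw [inner_cubeVec]
  refine Finset.sum_congr rfl fun j _ => ?_
  simp only [signed]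
  ring

/-- Independent uniform signs and absolute values of Gaussian variables make up a standard
Gaussian vector. -/
lemma sum_lintegral_signed {Φ : EuclideanSpace ℝ (Fin m) → ℝ≥0∞} (hΦ : Measurable Φ) :
    ∑ x : Fin m → Bool, ∫⁻ g, Φ (signed x g) ∂(gaussianPi m)
      = 2 ^ m * ∫⁻ G, Φ G ∂(stdGaussian (EuclideanSpace ℝ (Fin m))) := by
  have hpres : ∀ x : Fin m → Bool,
      MeasurePreserving (fun (g : Fin m → ℝ) j => sgn (x j) * g j) (gaussianPi m)
        (gaussianPi m) := by
    intro x
    refine measurePreserving_pi _ _ fun j => ⟨measurable_const_mul _, ?_⟩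
    rw [gaussianReal_map_const_mul]
    rcases sgn_eq_or (x j) with h | h <;> simp [h]
  have hflip : ∀ x : Fin m → Bool,
      ∫⁻ g, Φ (WithLp.toLp 2 fun j => sgn (x j) * g j) ∂(gaussianPi m)
        = ∫⁻ G, Φ G ∂(stdGaussian (EuclideanSpace ℝ (Fin m))) := by
    intro x
    rw [← map_pi_eq_stdGaussian, lintegral_map hΦ (by fun_prop)]
    exact (hpres x).lintegral_comp (f := fun g => Φ (WithLp.toLp 2 g)) (by fun_prop)
  have hpt : ∀ g : Fin m → ℝ, ∑ x : Fin m → Bool, Φ (signed x g)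
      = ∑ x : Fin m → Bool, Φ (WithLp.toLp 2 fun j => sgn (x j) * g j) := by
    intro g
    have hinv : Function.Involutive
        fun (x : Fin m → Bool) j => xor (x j) (decide (g j < 0)) := by
      intro x
      funext j
      simp
    rw [← Equiv.sum_comp hinv.toPerm]
    refine Finset.sum_congr rfl fun x _ => ?_
    rw [signed]
    congr 2
    funext j
    rw [Function.Involutive.coe_toPerm]
    by_cases h : g j < 0
    · simp [h, abs_of_neg h, sgn_not]
    · simp [h, abs_of_nonneg (not_lt.1 h)]
  have hms : ∀ x : Fin m → Bool, Measurable fun g => Φ (signed x g) := fun x =>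
    hΦ.comp (measurable_signed x)
  have hmf : ∀ x : Fin m → Bool,
      Measurable fun g : Fin m → ℝ => Φ (WithLp.toLp 2 fun j => sgn (x j) * g j) := fun x =>
    hΦ.comp (by fun_prop)
  rw [← lintegral_finsetSum _ fun x _ => hms x]
  simp only [hpt]
  rw [lintegral_finsetSum _ fun x _ => hmf x]
  simp [hflip]

lemma gaussianPi_signed_sum_ge_le {μ₀ v s₀ : ℝ} (h0 : 0 ≤ μ₀) (h1 : μ₀ ≤ 1) (hv : 0 < v)
    (hmgf : ∀ s : ℝ, |s| ≤ s₀ →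
      ∫ g, exp (s * |g|) ∂(gaussianReal 0 1) ≤ exp (s * μ₀ + v * s ^ 2 / 2))
    {T T' : ℝ} (hT : 0 ≤ T) (hTT' : T ≤ T') (hm : 0 < m) (hs : (T' - T) / v ≤ s₀ * √m)
    {ε : Fin m → ℝ} (hε : ∀ j, ε j = 1 ∨ ε j = -1) (hsum : ∑ j, ε j ≤ T * √m) :
    (gaussianPi m).real {g | T' * √m ≤ ∑ j, ε j * |g j|} ≤ exp (-(T' - T) ^ 2 / (2 * v)) := by
  have hm' : (0 : ℝ) < √m := by positivity
  have hsq : √(m : ℝ) ^ 2 = m := Real.sq_sqrt (by positivity)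
  set θ := (T' - T) / v with hθ
  have hθ0 : 0 ≤ θ := div_nonneg (by linarith) hv.le
  set t := θ / √m with ht
  have ht0 : 0 ≤ t := by positivity
  have hts : t ≤ s₀ := by rwa [ht, div_le_iff₀ hm']
  have hprod : ∀ g : Fin m → ℝ,
      exp (t * ∑ j, ε j * |g j|) = ∏ j, exp (t * ε j * |g j|) := by
    intro g
    rw [← exp_sum, Finset.mul_sum]
    simp only [mul_assoc]
  have hint1 : ∀ j, Integrable (fun g : ℝ => exp (t * ε j * |g|)) (gaussianReal 0 1) := fun j =>
    integrable_exp_mul_abs (by simpa using integrable_exp_mul_gaussianReal (t * ε j))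
      (by simpa using integrable_exp_mul_gaussianReal (-(t * ε j)))
  have hint : Integrable (fun g : Fin m → ℝ => exp (t * ∑ j, ε j * |g j|)) (gaussianPi m) := by
    simp only [hprod]
    exact Integrable.fintype_prod_dep hint1
  have hle : mgf (fun g : Fin m → ℝ => ∑ j, ε j * |g j|) (gaussianPi m) t
      ≤ exp (θ * T + v * θ ^ 2 / 2) := by
    rw [mgf]
    simp only [hprod]
    rw [integral_fintype_prod_eq_prod (𝕜 := ℝ) fun j g => exp (t * ε j * |g|)]
    calc ∏ j, ∫ g, exp (t * ε j * |g|) ∂(gaussianReal 0 1)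
        ≤ ∏ j, exp (t * ε j * μ₀ + v * t ^ 2 / 2) := by
          refine Finset.prod_le_prod (fun j _ => integral_nonneg fun g => (exp_pos _).le)
            fun j _ => ?_
          have hsq1 : (t * ε j) ^ 2 = t ^ 2 := by
            rcases hε j with h | h <;> simp [h]
          rw [← hsq1]
          refine hmgf _ ?_
          rcases hε j with h | h <;> simpa [h, abs_of_nonneg ht0] using hts
      _ = exp (t * μ₀ * ∑ j, ε j + m * (v * t ^ 2 / 2)) := by
          rw [← exp_sum, Finset.sum_add_distrib, Finset.mul_sum]
          simp only [Finset.sum_const, Finset.card_univ, Fintype.card_fin, nsmul_eq_mul]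
          congr 2
          exact Finset.sum_congr rfl fun j _ => by ring
      _ ≤ exp (θ * T + v * θ ^ 2 / 2) := by
          apply exp_le_exp.2
          have e1 : t * μ₀ * ∑ j, ε j ≤ t * 1 * (T * √m) := by
            calc t * μ₀ * ∑ j, ε j ≤ t * μ₀ * (T * √m) := by gcongr
              _ ≤ _ := by gcongr
          have e2 : t * 1 * (T * √m) = θ * T := by
            rw [ht]; field_simp
          have e3 : m * (v * t ^ 2 / 2) = v * θ ^ 2 / 2 := by
            rw [ht, div_pow, hsq]; field_simp
          linarith
  have hmk := measure_ge_le_exp_mul_mgf (T' * √m) ht0 hint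
  refine hmk.trans ((mul_le_mul_of_nonneg_left hle (exp_pos _).le).trans (le_of_eq ?_))
  rw [← exp_add]
  congr 1
  have e4 : t * (T' * √m) = θ * T' := by rw [ht]; field_simp
  rw [neg_mul, e4, hθ]
  field_simp
  ring

/-- If the bit strings `x` and `y` have small correlation, then so have with high probability the
sign vector of `y` and the Gaussian vector with signs `x`. -/
lemma gaussianPi_lt_abs_inner_signed_le {μ₀ v s₀ : ℝ} (h0 : 0 ≤ μ₀) (h1 : μ₀ ≤ 1) (hv : 0 < v)
    (hmgf : ∀ s : ℝ, |s| ≤ s₀ →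
      ∫ g, exp (s * |g|) ∂(gaussianReal 0 1) ≤ exp (s * μ₀ + v * s ^ 2 / 2))
    {T T' : ℝ} (hT : 0 ≤ T) (hTT' : T ≤ T') (hm : 0 < m) (hs : (T' - T) / v ≤ s₀ * √m)
    {x y : Fin m → Bool} (hxy : |corr x y| ≤ T * √m) :
    (gaussianPi m).real {g | T' * √m < |⟪cubeVec y, signed x g⟫|}
      ≤ 2 * exp (-(T' - T) ^ 2 / (2 * v)) := by
  have hpm : ∀ j, sgn (x j) * sgn (y j) = 1 ∨ sgn (x j) * sgn (y j) = -1 := by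
    intro j
    cases x j <;> cases y j <;> simp [sgn]
  have a1 := gaussianPi_signed_sum_ge_le h0 h1 hv hmgf hT hTT' hm hs hpm (abs_le.1 hxy).2
  have a2 := gaussianPi_signed_sum_ge_le h0 h1 hv hmgf hT hTT' hm hs
    (ε := fun j => -(sgn (x j) * sgn (y j)))
    (fun j => by rcases hpm j with h | h <;> simp [h])
    (by
      rw [Finset.sum_neg_distrib]
      have := (abs_le.1 hxy).1
      unfold corr at this
      linarith)
  refine le_trans (measureReal_mono ?_) ((measureReal_union_le _ _).trans
    ((add_le_add a1 a2).trans (two_mul _).ge))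
  intro g hg
  simp only [Set.mem_ofPred_eq, inner_cubeVec_signed] at hg
  rcases lt_abs.1 hg with h | h
  · exact Or.inl h.le
  · right
    simp only [Set.mem_ofPred_eq, neg_mul, Finset.sum_neg_distrib]
    exact h.le

/-! ### Products of penalties along nearly orthogonal sign vectors -/

/-- The penalty `exp (-1)` on values beyond the threshold `τ` in absolute value. -/
noncomputable def penalty (τ u : ℝ) : ℝ≥0∞ :=
  ENNReal.ofReal (exp (-(if τ < |u| then 1 else 0)))

lemma measurable_penalty (τ : ℝ) : Measurable (penalty τ) := by
  unfold penalty
  refine ENNReal.measurable_ofReal.comp (measurable_exp.comp (Measurable.neg ?_))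
  exact Measurable.ite (measurableSet_lt measurable_const measurable_id.abs)
    measurable_const measurable_const

lemma measurable_prod_map_penalty (l : List (Fin m → Bool)) (τ : ℝ) :
    Measurable fun G : EuclideanSpace ℝ (Fin m) =>
      (l.map fun y => penalty τ ⟪cubeVec y, G⟫).prod := by
  induction l with
  | nil => simp
  | cons y l ih =>
    simp only [List.map_cons, List.prod_cons]
    exact ((measurable_penalty τ).comp (innerSL ℝ (cubeVec y)).continuous.measurable).mul ih

/-- The expected penalty of a shifted Gaussian is at most `exp (-p / 2)`, where `p` bounds the
one-sided Gaussian tail from below: whatever the shift, one of the two tails is at least as likely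
as without it. -/
lemma lintegral_penalty_le {T σ p : ℝ} (hT : 0 ≤ T) (hσ : 0 < σ)
    (hp : p ≤ (gaussianReal 0 1).real (Set.Ioi (T / σ))) (hm : 0 < m)
    {r : EuclideanSpace ℝ (Fin m)} (hr : σ * √m ≤ ‖r‖) (a : ℝ) :
    ∫⁻ G, penalty (T * √m) (a + ⟪r, G⟫) ∂(stdGaussian (EuclideanSpace ℝ (Fin m)))
      ≤ ENNReal.ofReal (exp (-p / 2)) := by
  have hm' : (0 : ℝ) < √m := by positivity
  have hr0 : 0 < ‖r‖ := lt_of_lt_of_le (by positivity) hr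
  have hR : Measurable fun G : EuclideanSpace ℝ (Fin m) => ⟪r, G⟫ :=
    (innerSL ℝ r).continuous.measurable
  have hscale : (gaussianReal 0 1).map (‖r‖ * ·) = gaussianReal 0 (‖r‖ ^ 2).toNNReal := by
    rw [gaussianReal_map_const_mul]
    congr 1
    · simp
    · ext
      simp
  have hpm : Measurable fun t => penalty (T * √m) (a + t) :=
    (measurable_penalty _).comp (measurable_const_add a)
  rw [← lintegral_map (μ := stdGaussian (EuclideanSpace ℝ (Fin m))) hpm hR,
    map_inner_stdGaussian, ← hscale, lintegral_map hpm (measurable_const_mul _)]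
  set S : Set ℝ := {t | T * √m < |a + ‖r‖ * t|} with hS
  have hSm : MeasurableSet S :=
    measurableSet_lt measurable_const ((measurable_id.const_mul _).const_add a).abs
  have hTr : T * √m ≤ ‖r‖ * (T / σ) := by
    calc T * √m = (σ * √m) * (T / σ) := by field_simp
      _ ≤ _ := by gcongr
  have hpS : p ≤ (gaussianReal 0 1).real S := by
    rcases le_total 0 a with ha | ha
    · refine hp.trans (measureReal_mono fun t ht => ?_)
      have : ‖r‖ * (T / σ) < ‖r‖ * t := mul_lt_mul_of_pos_left ht hr0
      exact lt_of_lt_of_le (by linarith : T * √m < a + ‖r‖ * t) (le_abs_self _)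
    · have hneg : (gaussianReal 0 1).real (Set.Iio (-(T / σ)))
          = (gaussianReal 0 1).real (Set.Ioi (T / σ)) := by
        have h := gaussianReal_map_neg (μ := 0) (v := 1)
        rw [neg_zero] at h
        rw [measureReal_def, measureReal_def]
        nth_rewrite 2 [← h]
        rw [Measure.map_apply measurable_neg measurableSet_Ioi]
        simp
      rw [← hneg] at hp
      refine hp.trans (measureReal_mono fun t ht => ?_)
      have : ‖r‖ * t < ‖r‖ * -(T / σ) := mul_lt_mul_of_pos_left ht hr0
      exact lt_of_lt_of_le (by linarith : T * √m < -(a + ‖r‖ * t)) (neg_le_abs _)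
  have hbound : ∀ t : ℝ, exp (-(if T * √m < |a + ‖r‖ * t| then (1 : ℝ) else 0))
      ≤ 1 - 1 / 2 * S.indicator 1 t := by
    intro t
    have he : exp (-1 : ℝ) ≤ 1 / 2 := by
      rw [exp_neg, ← one_div]
      exact one_div_le_one_div_of_le (by norm_num) (by linarith [add_one_le_exp (1 : ℝ)])
    by_cases ht : t ∈ S
    · have ht' : T * √m < |a + ‖r‖ * t| := ht
      rw [if_pos ht', Set.indicator_of_mem ht]
      simp only [Pi.one_apply]
      linarith
    · have ht' : ¬ T * √m < |a + ‖r‖ * t| := ht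
      rw [if_neg ht', Set.indicator_of_notMem ht]
      simp
  have hind : Integrable (S.indicator (1 : ℝ → ℝ)) (gaussianReal 0 1) :=
    (integrable_const (1 : ℝ)).indicator hSm
  have hint : Integrable (fun t : ℝ => 1 - 1 / 2 * S.indicator (1 : ℝ → ℝ) t)
      (gaussianReal 0 1) := (integrable_const _).sub (hind.const_mul _)
  calc ∫⁻ t, penalty (T * √m) (a + ‖r‖ * t) ∂(gaussianReal 0 1)
      ≤ ∫⁻ t, ENNReal.ofReal (1 - 1 / 2 * S.indicator 1 t) ∂(gaussianReal 0 1) :=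
        lintegral_mono fun t => ENNReal.ofReal_le_ofReal (hbound t)
    _ = ENNReal.ofReal (∫ t, (1 - 1 / 2 * S.indicator 1 t) ∂(gaussianReal 0 1)) :=
        (ofReal_integral_eq_lintegral_ofReal hint (Filter.Eventually.of_forall fun t =>
          (exp_pos _).le.trans (hbound t))).symm
    _ ≤ ENNReal.ofReal (exp (-p / 2)) := by
        apply ENNReal.ofReal_le_ofReal
        rw [integral_sub (integrable_const _) (hind.const_mul _), integral_const_mul,
          integral_indicator_one hSm]
        simp only [integral_const, probReal_univ, smul_eq_mul, mul_one]
        have := add_one_le_exp (-p / 2)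
        linarith

/-- If a set of sign vectors is not within distance `σ√m` of any subspace of dimension at most `k`,
then one can choose up to `k` of its elements one after the other such that the expected product of
the penalties of their inner products with a Gaussian vector is exponentially small. -/
lemma exists_list_lintegral_penalty_le {T σ p : ℝ} (hT : 0 ≤ T) (hσ : 0 < σ)
    (hp : p ≤ (gaussianReal 0 1).real (Set.Ioi (T / σ))) (hm : 0 < m)
    (B : Finset (Fin m → Bool)) (k : ℕ)
    (hB : ∀ V : Submodule ℝ (EuclideanSpace ℝ (Fin m)), Module.finrank ℝ V ≤ k →
      ∃ y ∈ B, σ * √m ≤ ‖cubeVec y - V.starProjection (cubeVec y)‖) :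
    ∀ i ≤ k, ∃ l : List (Fin m → Bool), l.length = i ∧ (∀ y ∈ l, y ∈ B) ∧
      ∫⁻ G, (l.map fun y => penalty (T * √m) ⟪cubeVec y, G⟫).prod
        ∂(stdGaussian (EuclideanSpace ℝ (Fin m))) ≤ ENNReal.ofReal (exp (-p / 2)) ^ i := by
  classical
  intro i
  induction i with
  | zero => exact fun _ => ⟨[], by simp⟩
  | succ i ih =>
    intro hi
    obtain ⟨l, hlen, hlB, hl⟩ := ih (Nat.le_of_succ_le hi)
    set V := Submodule.span ℝ
      ((l.map cubeVec).toFinset : Set (EuclideanSpace ℝ (Fin m))) with hV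
    have hfin : Module.finrank ℝ V ≤ k := by
      refine (finrank_span_finset_le_card _).trans ((List.toFinset_card_le _).trans ?_)
      rw [List.length_map, hlen]
      exact Nat.le_of_succ_le hi
    obtain ⟨y, hyB, hy⟩ := hB V hfin
    refine ⟨y :: l, by simp [hlen], by simpa [hyB] using hlB, ?_⟩
    have hFV : ∀ G, (l.map fun z => penalty (T * √m) ⟪cubeVec z, V.starProjection G⟫).prod
        = (l.map fun z => penalty (T * √m) ⟪cubeVec z, G⟫).prod := by
      intro G
      congr 1
      refine List.map_congr_left fun z hz => ?_
      have hzV : cubeVec z ∈ V := Submodule.subset_span (by simpa using ⟨z, hz, rfl⟩)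
      rw [← Submodule.inner_starProjection_left_eq_right,
        Submodule.starProjection_eq_self_iff.2 hzV]
    have hstep := lintegral_mul_le_of_shift_le V
      (measurable_prod_map_penalty l (T * √m)) hFV (measurable_penalty (T * √m))
      (cubeVec y) (lintegral_penalty_le hT hσ hp hm hy)
    simp only [List.map_cons, List.prod_cons, pow_succ']
    simp only [mul_comm (penalty _ ⟪cubeVec y, _⟫)]
    exact hstep.trans (by gcongr)

/-! ### Spread of the correlation on large rectangles -/

lemma prod_map_penalty (l : List (Fin m → Bool)) (τ : ℝ) (G : EuclideanSpace ℝ (Fin m)) :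
    (l.map fun y => penalty τ ⟪cubeVec y, G⟫).prod
      = ENNReal.ofReal
        (exp (-(l.map fun y => if τ < |⟪cubeVec y, G⟫| then (1 : ℝ) else 0).sum)) := by
  induction l with
  | nil => simp
  | cons y l ih =>
    simp only [List.map_cons, List.prod_cons, List.sum_cons]
    rw [ih, penalty, ← ENNReal.ofReal_mul (exp_pos _).le, ← exp_add, neg_add]

open Finset in
/-- If every string in the list `l` has large correlation with few strings in `A`, while the
expected product of penalties over `l` is small, then `A` is small. The lower bound for the
expected product of penalties over Gaussian vectors with signs in `A` is Jensen's inequality. -/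
lemma card_le_of_lintegral_penalty_le {T T' p₁ q : ℝ} (hp₁ : 0 ≤ p₁)
    (hnoise : ∀ x y : Fin m → Bool, |corr x y| ≤ T * √m →
      (gaussianPi m).real {g | T' * √m < |⟪cubeVec y, signed x g⟫|} ≤ p₁)
    (A : Finset (Fin m → Bool)) (l : List (Fin m → Bool))
    (hl : ∀ y ∈ l, (#{x ∈ A | T * √m < |corr x y|} : ℝ) ≤ p₁ * #A)
    (hq : ∫⁻ G, (l.map fun y => penalty (T' * √m) ⟪cubeVec y, G⟫).prod
        ∂(stdGaussian (EuclideanSpace ℝ (Fin m))) ≤ ENNReal.ofReal (exp (-q / 2)) ^ l.length) :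
    (#A : ℝ) ≤ 2 ^ m * exp (-((q / 2 - 2 * p₁) * l.length)) := by
  classical
  set k : ℝ := (l.length : ℝ) with hk
  set z : ℝ := 2 * p₁ * k with hz
  set N : (Fin m → Bool) → (Fin m → ℝ) → ℝ := fun x g =>
    (l.map fun y => if T' * √m < |⟪cubeVec y, signed x g⟫| then (1 : ℝ) else 0).sum with hN
  set S : (Fin m → Bool) → (Fin m → Bool) → Set (Fin m → ℝ) := fun x y =>
    {g | T' * √m < |⟪cubeVec y, signed x g⟫|} with hS
  have hSm : ∀ x y, MeasurableSet (S x y) := fun x y =>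
    measurableSet_lt measurable_const
      ((innerSL ℝ (cubeVec y)).continuous.measurable.comp (measurable_signed x)).abs
  have hI : ∀ x y, Integrable (fun g : Fin m → ℝ =>
      if T' * √m < |⟪cubeVec y, signed x g⟫| then (1 : ℝ) else 0) (gaussianPi m) := by
    intro x y
    have h := (integrable_const (μ := gaussianPi m) (1 : ℝ)).indicator (hSm x y)
    refine h.congr (Filter.Eventually.of_forall fun g => ?_)
    simp [Set.indicator_apply, hS]
  have hIv : ∀ x y, ∫ g : Fin m → ℝ,
      (if T' * √m < |⟪cubeVec y, signed x g⟫| then (1 : ℝ) else 0) ∂(gaussianPi m)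
        = (gaussianPi m).real (S x y) := by
    intro x y
    rw [← integral_indicator_one (hSm x y)]
    refine integral_congr_ae (Filter.Eventually.of_forall fun g => ?_)
    simp [Set.indicator_apply, hS]
  have hlist : ∀ (x : Fin m → Bool) (l : List (Fin m → Bool)), Integrable (fun g =>
        (l.map fun y => if T' * √m < |⟪cubeVec y, signed x g⟫| then (1 : ℝ) else 0).sum)
        (gaussianPi m) ∧
      ∫ g, (l.map fun y => if T' * √m < |⟪cubeVec y, signed x g⟫| then (1 : ℝ) else 0).sum
        ∂(gaussianPi m) = (l.map fun y => (gaussianPi m).real (S x y)).sum := by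
    intro x l
    induction l with
    | nil => simp
    | cons y l ih =>
      simp only [List.map_cons, List.sum_cons]
      refine ⟨(hI x y).add ih.1, ?_⟩
      rw [integral_add (hI x y) ih.1, hIv, ih.2]
  have hNI : ∀ x, Integrable (N x) (gaussianPi m) ∧
      ∫ g, N x g ∂(gaussianPi m) = (l.map fun y => (gaussianPi m).real (S x y)).sum := fun x =>
    hlist x l
  have hsumS : ∀ y ∈ l, ∑ x ∈ A, (gaussianPi m).real (S x y) ≤ 2 * p₁ * #A := by
    intro y hy
    calc ∑ x ∈ A, (gaussianPi m).real (S x y)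
        ≤ ∑ x ∈ A, ((if T * √m < |corr x y| then (1 : ℝ) else 0) + p₁) := by
          refine sum_le_sum fun x _ => ?_
          by_cases h : T * √m < |corr x y|
          · rw [if_pos h]
            exact measureReal_le_one.trans (le_add_of_nonneg_right hp₁)
          · rw [if_neg h, zero_add]
            exact hnoise x y (not_lt.1 h)
      _ = #{x ∈ A | T * √m < |corr x y|} + p₁ * #A := by
          rw [sum_add_distrib, sum_boole, sum_const, nsmul_eq_mul]
          ring
      _ ≤ 2 * p₁ * #A := by linarith [hl y hy]
  have hsumN : ∑ x ∈ A, ∫ g, N x g ∂(gaussianPi m) ≤ z * #A := by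
    simp only [fun x => (hNI x).2]
    have h1 : ∀ l : List (Fin m → Bool),
        ∑ x ∈ A, (l.map fun y => (gaussianPi m).real (S x y)).sum
          = (l.map fun y => ∑ x ∈ A, (gaussianPi m).real (S x y)).sum := by
      intro l
      induction l with
      | nil => simp
      | cons y l ih => simp [sum_add_distrib, ih]
    rw [h1]
    refine (List.sum_le_card_nsmul _ (2 * p₁ * #A) ?_).trans (le_of_eq ?_)
    · intro t ht
      obtain ⟨y, hy, rfl⟩ := List.mem_map.1 ht
      exact hsumS y hy
    · rw [List.length_map, nsmul_eq_mul, hz, hk]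
      ring
  -- The tangent line of `exp (-·)` at `z` bounds the product of penalties from below.
  have htan : ∀ x g, exp (-z) * (1 + z - N x g) ≤ exp (-N x g) := by
    intro x g
    have h := add_one_le_exp (z - N x g)
    calc exp (-z) * (1 + z - N x g) ≤ exp (-z) * exp (z - N x g) := by
          gcongr
          linarith
      _ = exp (-N x g) := by rw [← exp_add]; ring_nf
  have hlow : ENNReal.ofReal (exp (-z) * #A)
      ≤ ∑ x ∈ A, ∫⁻ g, ENNReal.ofReal (exp (-N x g)) ∂(gaussianPi m) := by
    have h1 : ∀ x, ENNReal.ofReal (exp (-z) * (1 + z - ∫ g, N x g ∂(gaussianPi m)))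
        ≤ ∫⁻ g, ENNReal.ofReal (exp (-N x g)) ∂(gaussianPi m) := by
      intro x
      have hi : Integrable (fun g => exp (-z) * (1 + z - N x g)) (gaussianPi m) :=
        ((integrable_const (1 + z)).sub (hNI x).1).const_mul _
      have h2 : ∫ g, exp (-z) * (1 + z - N x g) ∂(gaussianPi m)
          = exp (-z) * (1 + z - ∫ g, N x g ∂(gaussianPi m)) := by
        rw [integral_const_mul, integral_sub (integrable_const _) (hNI x).1]
        simp
      rw [← h2]
      have hexp : Integrable (fun g => exp (-N x g)) (gaussianPi m) := by
        refine Integrable.of_bound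
          (hNI x).1.aestronglyMeasurable.aemeasurable.neg.exp.aestronglyMeasurable 1
          (Filter.Eventually.of_forall fun g => ?_)
        rw [Real.norm_eq_abs, abs_of_pos (exp_pos _)]
        apply exp_le_one_iff.2
        rw [neg_nonpos]
        refine List.sum_nonneg fun t ht => ?_
        obtain ⟨y, -, rfl⟩ := List.mem_map.1 ht
        split_ifs <;> norm_num
      rw [← ofReal_integral_eq_lintegral_ofReal hexp
        (Filter.Eventually.of_forall fun g => (exp_pos _).le)]
      exact ENNReal.ofReal_le_ofReal (integral_mono hi hexp fun g => htan x g)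
    calc ENNReal.ofReal (exp (-z) * #A)
        ≤ ENNReal.ofReal (∑ x ∈ A, exp (-z) * (1 + z - ∫ g, N x g ∂(gaussianPi m))) := by
          apply ENNReal.ofReal_le_ofReal
          rw [← mul_sum, sum_sub_distrib, sum_const, nsmul_eq_mul]
          gcongr
          linarith
      _ ≤ ∑ x ∈ A, ENNReal.ofReal (exp (-z) * (1 + z - ∫ g, N x g ∂(gaussianPi m))) :=
          le_sum_of_subadditive _ ENNReal.ofReal_zero.le
            (fun _ _ => ENNReal.ofReal_add_le) _ _
      _ ≤ _ := sum_le_sum fun x _ => h1 x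
  have hup : ∑ x ∈ A, ∫⁻ g, ENNReal.ofReal (exp (-N x g)) ∂(gaussianPi m)
      ≤ ENNReal.ofReal (2 ^ m * exp (-q / 2 * k)) := by
    calc ∑ x ∈ A, ∫⁻ g, ENNReal.ofReal (exp (-N x g)) ∂(gaussianPi m)
        ≤ ∑ x : Fin m → Bool, ∫⁻ g, ENNReal.ofReal (exp (-N x g)) ∂(gaussianPi m) :=
          sum_le_sum_of_subset (subset_univ _)
      _ = ∑ x : Fin m → Bool, ∫⁻ g, (l.map fun y =>
            penalty (T' * √m) ⟪cubeVec y, signed x g⟫).prod ∂(gaussianPi m) := by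
          simp only [prod_map_penalty, hN]
      _ ≤ 2 ^ m * ENNReal.ofReal (exp (-q / 2)) ^ l.length := by
          rw [sum_lintegral_signed (measurable_prod_map_penalty l _)]
          gcongr
      _ = ENNReal.ofReal (2 ^ m * exp (-q / 2 * k)) := by
          rw [ENNReal.ofReal_mul (by positivity), ← ENNReal.ofReal_pow (exp_pos _).le,
            ← exp_nat_mul, ENNReal.ofReal_pow (by norm_num), hk]
          congr 2
          · simp
          · ring_nf
  have hfin := (ENNReal.ofReal_le_ofReal_iff (by positivity)).1 (hlow.trans hup)
  have hzz : exp z * exp (-z) = 1 := by rw [← exp_add]; simp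
  calc (#A : ℝ) = exp z * (exp (-z) * #A) := by rw [← mul_assoc, hzz, one_mul]
    _ ≤ exp z * (2 ^ m * exp (-q / 2 * k)) := by gcongr
    _ = 2 ^ m * (exp z * exp (-q / 2 * k)) := by ring
    _ = _ := by
        rw [← exp_add, hz]
        ring_nf

open Finset in
/-- Anticoncentration of the correlation on large rectangles. -/
lemma largeRectanglesSpread {T : ℝ} (hT : 0 ≤ T) : LargeRectanglesSpread T := by
  classical
  obtain ⟨μ₀, v, s₀, h0, h1, hv0, hv1, hs₀, hmgf⟩ := exists_mgf_abs_gaussian_le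
  set σ := √((1 + v) / 2) with hσ
  have hσ0 : 0 < σ := by positivity
  have hσv : √v < σ := Real.sqrt_lt_sqrt hv0.le (by linarith)
  have hσsq : σ ^ 2 = (1 + v) / 2 := Real.sq_sqrt (by positivity)
  obtain ⟨T', hTT', hthr⟩ := exists_threshold hT hv0 hσv
  set p₁ := 2 * exp (-(T' - T) ^ 2 / (2 * v)) with hp₁
  set q := (gaussianReal 0 1).real (Set.Ioi (T' / σ))
  have hp₁0 : 0 < p₁ := by positivity
  have hq0 : 0 < q := by linarith
  obtain ⟨a, ha, K, hK1, hproj⟩ := exists_sum_exp_norm_starProjection_sq_le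
  set β := a * (1 - σ ^ 2) / 2 with hβ
  have hβ0 : 0 < β := by
    have : 0 < 1 - σ ^ 2 := by rw [hσsq]; linarith
    positivity
  set κ := β / K with hκ
  have hκ0 : 0 < κ := by positivity
  set c := min (β / 2) (q * κ / 16) with hc
  have hc0 : 0 < c := by positivity
  refine ⟨c, hc0, p₁ / 2, by positivity,
    max 1 (max ⌈2 / κ⌉₊ (max ⌈2 / β⌉₊ ⌈((T' - T) / v / s₀) ^ 2⌉₊)),
    fun m hmM A B hA hB => ?_⟩
  have hm : 0 < m := lt_of_lt_of_le one_pos (le_of_max_le_left hmM)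
  have hmM' := le_of_max_le_right hmM
  have hmκ : 2 ≤ κ * m := by
    rw [← div_le_iff₀' hκ0]
    exact (Nat.le_ceil _).trans (by exact_mod_cast le_of_max_le_left hmM')
  have hmM'' := le_of_max_le_right hmM'
  have hmβ : 2 ≤ β * m := by
    rw [← div_le_iff₀' hβ0]
    exact (Nat.le_ceil _).trans (by exact_mod_cast le_of_max_le_left hmM'')
  have hms : (T' - T) / v ≤ s₀ * √m := by
    rw [← div_le_iff₀' hs₀]
    apply Real.le_sqrt_of_sq_le
    exact (Nat.le_ceil _).trans (by exact_mod_cast le_of_max_le_right hmM'')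
  have hnoise : ∀ x y : Fin m → Bool, |corr x y| ≤ T * √m →
      (gaussianPi m).real {g | T' * √m < |⟪cubeVec y, signed x g⟫|} ≤ p₁ := fun x y hxy =>
    gaussianPi_lt_abs_inner_signed_le h0 h1 hv0 hmgf hT hTT' hm hms hxy
  have hA0 : (0 : ℝ) < #A := lt_of_lt_of_le (by positivity) hA
  have hB0 : (0 : ℝ) < #B := lt_of_lt_of_le (by positivity) hB
  by_contra! hcon
  set B' : Finset (Fin m → Bool) :=
    B.filter fun y => (#{x ∈ A | T * √m < |corr x y|} : ℝ) ≤ p₁ * #A with hB'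
  set k := ⌊κ * m⌋₊ with hk
  have hkle : (k : ℝ) ≤ κ * m := Nat.floor_le (by positivity)
  have hkge : κ * m / 2 ≤ k := by
    have := Nat.lt_floor_add_one (κ * m)
    linarith
  -- By Markov's inequality at least half of `B` has large correlation with few elements of `A`.
  have hB'card : (#B : ℝ) / 2 ≤ #B' := by
    set C := B.filter fun y => ¬ (#{x ∈ A | T * √m < |corr x y|} : ℝ) ≤ p₁ * #A with hC
    have hsplit : (#B : ℝ) = #B' + #C := by
      exact_mod_cast (card_filter_add_card_filter_not _).symm
    have hfar : (#((A ×ˢ B).filter fun p => T * √m < |corr p.1 p.2|) : ℝ)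
        = ∑ y ∈ B, (#{x ∈ A | T * √m < |corr x y|} : ℝ) := by
      rw [card_filter, sum_product_right]
      push_cast
      refine sum_congr rfl fun y _ => ?_
      rw [sum_boole]
    have hCle : #C * (p₁ * #A) ≤ ∑ y ∈ B, (#{x ∈ A | T * √m < |corr x y|} : ℝ) := by
      calc #C * (p₁ * #A) = ∑ y ∈ C, p₁ * #A := by rw [sum_const, nsmul_eq_mul]
        _ ≤ ∑ y ∈ C, (#{x ∈ A | T * √m < |corr x y|} : ℝ) :=
          sum_le_sum fun y hy => (not_le.1 (mem_filter.1 hy).2).le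
        _ ≤ _ := sum_le_sum_of_subset_of_nonneg (filter_subset _ _)
          fun _ _ _ => Nat.cast_nonneg _
    rw [hfar] at hcon
    have h2 : (#C : ℝ) * (p₁ * #A) < #B / 2 * (p₁ * #A) := by
      refine (hCle.trans_lt hcon).trans_le (le_of_eq ?_)
      ring
    have h3 := lt_of_mul_lt_mul_right h2 (by positivity)
    linarith
  -- Hence these elements do not all lie close to a subspace of dimension at most `k`.
  have hsel : ∀ V : Submodule ℝ (EuclideanSpace ℝ (Fin m)), Module.finrank ℝ V ≤ k →
      ∃ y ∈ B', σ * √m ≤ ‖cubeVec y - V.starProjection (cubeVec y)‖ := by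
    intro V hV
    by_contra! hclose
    have hpt : ∀ y ∈ B', exp (2 * β * m) ≤ exp (a * ‖V.starProjection (cubeVec y)‖ ^ 2) := by
      intro y hy
      apply exp_le_exp.2
      have h2 := hclose y hy
      have h3 : ‖cubeVec y - V.starProjection (cubeVec y)‖ ^ 2 ≤ σ ^ 2 * m := by
        calc _ ≤ (σ * √m) ^ 2 := by gcongr
          _ = σ ^ 2 * m := by rw [mul_pow, Real.sq_sqrt (Nat.cast_nonneg m)]
      have h4 : ‖cubeVec y‖ ^ 2 = ‖V.starProjection (cubeVec y)‖ ^ 2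
          + ‖cubeVec y - V.starProjection (cubeVec y)‖ ^ 2 := by
        have h5 := norm_add_sq_real (V.starProjection (cubeVec y))
          (cubeVec y - V.starProjection (cubeVec y))
        rw [add_sub_cancel, real_inner_comm,
          V.starProjection_inner_eq_zero _ _ (V.starProjection_apply_mem _)] at h5
        linarith
      rw [norm_cubeVec_sq] at h4
      calc 2 * β * m = a * (m - σ ^ 2 * m) := by rw [hβ]; ring
        _ ≤ _ := by gcongr; linarith
    have hsum : #B' * exp (2 * β * m) ≤ 2 ^ m * K ^ Module.finrank ℝ V := by
      calc #B' * exp (2 * β * m) = ∑ y ∈ B', exp (2 * β * m) := by rw [sum_const, nsmul_eq_mul]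
        _ ≤ ∑ y ∈ B', exp (a * ‖V.starProjection (cubeVec y)‖ ^ 2) := sum_le_sum hpt
        _ ≤ ∑ y : Fin m → Bool, exp (a * ‖V.starProjection (cubeVec y)‖ ^ 2) :=
          sum_le_sum_of_subset_of_nonneg (subset_univ _) fun _ _ _ => (exp_pos _).le
        _ ≤ _ := hproj m V
    have hKk : K ^ Module.finrank ℝ V ≤ exp (β * m) := by
      calc K ^ Module.finrank ℝ V ≤ K ^ k := pow_le_pow_right₀ hK1 hV
        _ ≤ exp K ^ k := by gcongr; linarith [add_one_le_exp K]
        _ = exp (k * K) := (exp_nat_mul _ _).symm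
        _ ≤ exp (β * m) := by
          apply exp_le_exp.2
          calc k * K ≤ κ * m * K := by gcongr
            _ = β * m := by rw [hκ]; field_simp
    have hcβ : c * m ≤ β / 2 * m := by gcongr; exact min_le_left _ _
    have hlow : exp (-(β / 2) * m) * 2 ^ m / 2 ≤ #B' := by
      refine le_trans ?_ hB'card
      refine div_le_div_of_nonneg_right (le_trans ?_ hB) zero_le_two
      exact mul_le_mul_of_nonneg_right (exp_le_exp.2 (by linarith)) (by positivity)
    have h6 : exp (-(β / 2) * m) * 2 ^ m / 2 * exp (2 * β * m) ≤ 2 ^ m * exp (β * m) := by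
      calc _ ≤ #B' * exp (2 * β * m) := by gcongr
        _ ≤ 2 ^ m * K ^ Module.finrank ℝ V := hsum
        _ ≤ _ := by gcongr
    have h7 : exp (β / 2 * m) ≤ 2 := by
      have e1 : exp (-(β / 2) * m) * exp (2 * β * m) = exp (β / 2 * m) * exp (β * m) := by
        rw [← exp_add, ← exp_add]
        ring_nf
      have e2 : exp (β / 2 * m) * (2 ^ m * exp (β * m)) ≤ 2 * (2 ^ m * exp (β * m)) := by
        calc _ = exp (-(β / 2) * m) * exp (2 * β * m) * 2 ^ m := by rw [e1]; ring
          _ = 2 * (exp (-(β / 2) * m) * 2 ^ m / 2 * exp (2 * β * m)) := by ring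
          _ ≤ _ := by gcongr
      exact le_of_mul_le_mul_right e2 (by positivity)
    have h8 : exp 1 ≤ exp (β / 2 * m) := exp_le_exp.2 (by linarith)
    linarith [Real.exp_one_gt_d9]
  obtain ⟨l, hlen, hlB, hl⟩ := exists_list_lintegral_penalty_le (hT.trans hTT') hσ0 le_rfl hm B' k
    hsel k le_rfl
  rw [← hlen] at hl
  have hcard := card_le_of_lintegral_penalty_le hp₁0.le hnoise A l
    (fun y hy => (mem_filter.1 (hlB y hy)).2) hl
  rw [hlen] at hcard
  have hexp : exp (-((q / 2 - 2 * p₁) * k)) < exp (-c * m) := by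
    apply exp_lt_exp.2
    have e1 : q / 4 * (κ * m / 2) ≤ (q / 2 - 2 * p₁) * k :=
      mul_le_mul (by linarith) hkge (by positivity) (by linarith)
    have e2 : c * m ≤ q * κ / 16 * m := by gcongr; exact min_le_right _ _
    have e3 : 0 < q * κ * m := by positivity
    linarith
  have : (2 : ℝ) ^ m * exp (-((q / 2 - 2 * p₁) * k)) < 2 ^ m * exp (-c * m) := by gcongr
  linarith

end Signs

end GapHamming

theorem theorem2p5 :
    ∃ ε : ℝ, 0 < ε ∧ ∃ c : ℝ, 0 < c ∧ ∃ N : ℕ, ∀ n : ℕ, N ≤ n →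
      c * (n : ℝ) ≤
        (CommComplexity.distComplexity
          (CommComplexity.GHD n ((n : ℝ) / 2) (Real.sqrt (n : ℝ)))
          (PMF.uniformOfFintype ((Fin n → Bool) × (Fin n → Bool))) ε : ℝ) :=
  GapHamming.distComplexity_of_spread (GapHamming.largeRectanglesSpread (by norm_num))
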